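/- All graphs are finite and simple. For a graph $G$, let $\rho(G)$ denote its spectral radius, i.e. the largest eigenvalue of its adjacency matrix, and let $\tau(G)$ denote its dissociation number, i.e. the largest size of a set $S\subseteq V(G)$ such that the induced subgraph $G[S]$ has maximum degree at most $1$. Let $\mathcal{D}_{n,4}$ be the set of all connected graphs of order $n$ with dissociation number $4$. For even $d$, let $CP_d$ be the cocktail party graph, i.e. the complement of a perfect matching in the complete graph $K_d$. A connecting edge $uv$ between two disjoint graphs $C_1$ and $C_2$ of orders $n_1$ and $n_2$, with $u\in C_1$ and $v\in C_2$, is called good if $u$ has degree $n_1-2$ in $C_1$ and $v$ has degree $n_2-2$ in $C_2$; $C_1-C_2$ denotes a graph obtained from the disjoint union of $C_1$ and $C_2$ by adding one good connecting edge. **Theorem.** Let $n\ge 8$ with $n\equiv 0\pmod 4$. Then the graph $CP_{n/2}-CP_{n/2}$ is the unique (up to isomorphism) graph of minimum spectral radius in $\mathcal{D}_{n,4}$. That is, a good connecting edge between two disjoint copies of $CP_{n/2}$ exists and, for every choice of such an edge, the resulting graph belongs to $\mathcal{D}_{n,4}$, has the smallest spectral radius among all graphs in $\mathcal{D}_{n,4}$,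 and every graph in $\mathcal{D}_{n,4}$ attaining this smallest spectral radius is isomorphic to it. -/

import Mathlib

/-- A set `S` of vertices is a dissociation set if the subgraph it induces has maximum degree at
most one. -/
def IsDissociationSet {V : Type*} [Fintype V] (G : SimpleGraph V) (S : Finset V) : Prop :=
  open Classical in (G.induce (S : Set V)).maxDegree ≤ 1

/-- The dissociation number: the size of a largest dissociation set. -/
noncomputable def dissociationNumber {V : Type*} [Fintype V] (G : SimpleGraph V) : ℕ :=
  open Classical in (Finset.univ.filter fun S : Finset V => IsDissociationSet G S).sup Finset.card

/-- The spectral radius of a graph: the largest (real) eigenvalue of its adjacency matrix. The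
spectrum is finite, and nonempty when `V` is, so the supremum is a maximum. -/
noncomputable def graphSpectralRadius {V : Type*} [Fintype V] (G : SimpleGraph V) : ℝ :=
  open Classical in sSup (spectrum ℝ (G.adjMatrix ℝ))

/-- Membership in the class of connected graphs of order `n` and dissociation number `τ`. -/
def IsConnectedWithDissociation {V : Type*} [Fintype V] (n τ : ℕ) (G : SimpleGraph V) : Prop :=
  Fintype.card V = n ∧ G.Connected ∧ dissociationNumber G = τ

/-- `G` has the minimum spectral radius among all connected graphs of order `n` and dissociation
number `τ` (each such graph is isomorphic to one with vertex set `Fin n`). -/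
def IsSpectralMinimizer {V : Type*} [Fintype V] (n τ : ℕ) (G : SimpleGraph V) : Prop :=
  IsConnectedWithDissociation n τ G ∧
    ∀ H : SimpleGraph (Fin n), IsConnectedWithDissociation n τ H →
      graphSpectralRadius G ≤ graphSpectralRadius H

/-- The perfect matching on `2 * k` vertices whose edges are the pairs `{(i, 0), (i, 1)}`. -/
def pairMatching (k : ℕ) : SimpleGraph (Fin k × Fin 2) where
  Adj x y := x.1 = y.1 ∧ x.2 ≠ y.2
  symm := ⟨fun _ _ h => ⟨h.1.symm, h.2.symm⟩⟩
  loopless := ⟨fun _ h => h.2 rfl⟩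

/-- For even `d`, the cocktail party graph on `d` vertices: the complement of a perfect matching
in the complete graph. -/
def cocktailParty (d : ℕ) : SimpleGraph (Fin (d / 2) × Fin 2) :=
  (pairMatching (d / 2))ᶜ

/-- The disjoint union of `C₁` and `C₂` together with the connecting edge `uv`. -/
def connectByEdge {V₁ V₂ : Type*} (C₁ : SimpleGraph V₁) (C₂ : SimpleGraph V₂)
    (u : V₁) (v : V₂) : SimpleGraph (V₁ ⊕ V₂) :=
  (C₁ ⊕g C₂) ⊔ SimpleGraph.edge (Sum.inl u) (Sum.inr v)

/-- The connecting edge `uv` is good if `u` has degree `|C₁| - 2` in `C₁` and `v` has degree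
`|C₂| - 2` in `C₂`. -/
def IsGoodConnectingEdge {V₁ V₂ : Type*} [Fintype V₁] [Fintype V₂]
    (C₁ : SimpleGraph V₁) (C₂ : SimpleGraph V₂) (u : V₁) (v : V₂) : Prop :=
  open Classical in
  C₁.degree u + 2 = Fintype.card V₁ ∧ C₂.degree v + 2 = Fintype.card V₂

/-! Write `n = 2 * d`, so that `d` is even and at least `4`. The spectral problem becomes an edge
count through the threshold `d - 2 + 2 / d`, the average degree of a graph of order `2 * d` with `d
* (d - 2) + 2` edges. A positive test vector puts the spectral radius of the joined cocktail party
graphs strictly below it (`graphSpectralRadius_connectByEdge_lt`). The spectral radius is at least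
the average degree, so every competitor that is at least as good has at most `d * (d - 2) + 1`
edges.

A graph of order `m` with no five dissociated vertices has at least `m * (m - 4) / 4` edges
(`card_sq_le`), which for `m = 2 * d` is `d * (d - 2)`. A competitor therefore exceeds the minimum
by at most one edge. This forces an independent quadruple whose vertices pair up (`exists_pairing`),
and the pairs extend to a partition of the vertex set into two parts in which every vertex misses at
most one other (`exists_nearComplete_partition`). Connectivity costs one crossing edge, which uses
up the slack: the parts have equal size, both are cocktail party graphs, and exactly one edge
crosses (`exists_tight_partition`). Cocktail party graphs are vertex-transitive, so the ends of that
edge do not matter up to isomorphism.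

Edges are counted by `adjCount` over ordered pairs, so `adjCount G W W` is twice the number of edges
inside `W`. -/

/-! ### Edge counting, and the edge bound without independent quadruples -/

section Combinatorics

variable {V : Type*}

/-- The adjacency indicator of a graph, as an integer. -/
noncomputable def adjInd (G : SimpleGraph V) (x y : V) : ℤ :=
  open Classical in if G.Adj x y then 1 else 0

/-- The number of ordered pairs in `S × T` which are adjacent. -/
noncomputable def adjCount (G : SimpleGraph V) (S T : Finset V) : ℤ :=
  ∑ x ∈ S, ∑ y ∈ T, adjInd G x y

/-- No five vertices induce a graph of maximum degree at most one. -/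
def NoFiveDissociated (G : SimpleGraph V) : Prop :=
  ∀ S : Finset V, (∀ x ∈ S, ∀ y ∈ S, ∀ z ∈ S, G.Adj x y → G.Adj x z → y = z) → S.card ≤ 4

/-- Every vertex of `A` has at most one other non-neighbour in `A`. -/
def NearComplete (G : SimpleGraph V) (A : Finset V) : Prop :=
  ∀ x ∈ A, ∀ y ∈ A, ∀ z ∈ A, x ≠ y → x ≠ z → ¬ G.Adj x y → ¬ G.Adj x z → y = z

variable {G : SimpleGraph V}

lemma adjInd_comm (x y : V) : adjInd G x y = adjInd G y x := by
  unfold adjInd; rw [G.adj_comm]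

lemma adjInd_nonneg (x y : V) : 0 ≤ adjInd G x y := by
  unfold adjInd; split_ifs <;> norm_num

lemma adjInd_of_adj {x y : V} (h : G.Adj x y) : adjInd G x y = 1 := by
  simp [adjInd, h]

lemma adjInd_of_not_adj {x y : V} (h : ¬ G.Adj x y) : adjInd G x y = 0 := by
  simp [adjInd, h]

lemma adjInd_eq_zero_iff {x y : V} : adjInd G x y = 0 ↔ ¬ G.Adj x y := by
  by_cases h : G.Adj x y <;> simp [adjInd, h]

lemma adjCount_comm (S T : Finset V) : adjCount G S T = adjCount G T S := by
  unfold adjCount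
  rw [Finset.sum_comm]
  exact Finset.sum_congr rfl fun _ _ => Finset.sum_congr rfl fun _ _ => adjInd_comm _ _

lemma adjCount_nonneg (S T : Finset V) : 0 ≤ adjCount G S T :=
  Finset.sum_nonneg fun _ _ => Finset.sum_nonneg fun _ _ => adjInd_nonneg _ _

lemma adjCount_union_left [DecidableEq V] {S T : Finset V} (h : Disjoint S T) (R : Finset V) :
    adjCount G (S ∪ T) R = adjCount G S R + adjCount G T R :=
  Finset.sum_union h

lemma adjCount_union_right [DecidableEq V] {S T : Finset V} (h : Disjoint S T) (R : Finset V) :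
    adjCount G R (S ∪ T) = adjCount G R S + adjCount G R T := by
  rw [adjCount_comm, adjCount_union_left h, adjCount_comm S, adjCount_comm T]

lemma adjCount_union_self [DecidableEq V] {S T : Finset V} (h : Disjoint S T) :
    adjCount G (S ∪ T) (S ∪ T) = adjCount G S S + adjCount G T T + 2 * adjCount G S T := by
  rw [adjCount_union_left h, adjCount_union_right h, adjCount_union_right h, adjCount_comm T S]
  ring

lemma adjCount_split [DecidableEq V] {S W : Finset V} (h : S ⊆ W) :
    adjCount G W W = adjCount G S S + adjCount G (W \ S) (W \ S) + 2 * adjCount G (W \ S) S := by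
  conv_lhs => rw [← Finset.union_sdiff_of_subset h]
  rw [adjCount_union_self Finset.disjoint_sdiff, adjCount_comm S (W \ S)]

lemma adjCount_mono_self [DecidableEq V] {S W : Finset V} (h : S ⊆ W) :
    adjCount G S S ≤ adjCount G W W := by
  have := adjCount_nonneg (G := G) (W \ S) (W \ S)
  have := adjCount_nonneg (G := G) (W \ S) S
  rw [adjCount_split h]; linarith

lemma adjCount_singleton_self (v : V) : adjCount G {v} {v} = 0 := by
  simp [adjCount, adjInd]

/-- Five vertices spanning no edges but possibly `p q` and `r s` do not exist. -/
lemma NoFiveDissociated.false_of_two_pairs (h : NoFiveDissociated G) {p q r s t : V}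
    (hpq : p ≠ q) (hpr : p ≠ r) (hps : p ≠ s) (hpt : p ≠ t) (hqr : q ≠ r) (hqs : q ≠ s)
    (hqt : q ≠ t) (hrs : r ≠ s) (hrt : r ≠ t) (hst : s ≠ t)
    (npr : ¬ G.Adj p r) (nps : ¬ G.Adj p s) (npt : ¬ G.Adj p t)
    (nqr : ¬ G.Adj q r) (nqs : ¬ G.Adj q s) (nqt : ¬ G.Adj q t)
    (nrt : ¬ G.Adj r t) (nst : ¬ G.Adj s t) : False := by
  classical
  have hc := h {p, q, r, s, t} ?_
  · have : ({p, q, r, s, t} : Finset V).card = 5 := by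
      simp [Finset.card_insert_of_notMem, *]
    omega
  · have nrp := fun h => npr (G.adj_symm h)
    have nsp := fun h => nps (G.adj_symm h)
    have ntp := fun h => npt (G.adj_symm h)
    have nrq := fun h => nqr (G.adj_symm h)
    have nsq := fun h => nqs (G.adj_symm h)
    have ntq := fun h => nqt (G.adj_symm h)
    have ntr := fun h => nrt (G.adj_symm h)
    have nts := fun h => nst (G.adj_symm h)
    have key : ∀ x ∈ ({p, q, r, s, t} : Finset V), ∀ y ∈ ({p, q, r, s, t} : Finset V),
        G.Adj x y → (x = p ∧ y = q) ∨ (x = q ∧ y = p) ∨ (x = r ∧ y = s) ∨ (x = s ∧ y = r) := by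
      intro x hx y hy hxy
      simp only [Finset.mem_insert, Finset.mem_singleton] at hx hy
      rcases hx with rfl | rfl | rfl | rfl | rfl <;>
        rcases hy with rfl | rfl | rfl | rfl | rfl <;> first
          | exact absurd hxy (G.irrefl)
          | contradiction
          | simp
    intro x hx y hy z hz hxy hxz
    rcases key x hx y hy hxy with ⟨h1, h2⟩ | ⟨h1, h2⟩ | ⟨h1, h2⟩ | ⟨h1, h2⟩ <;>
      rcases key x hx z hz hxz with ⟨h3, h4⟩ | ⟨h3, h4⟩ | ⟨h3, h4⟩ | ⟨h3, h4⟩ <;>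
      subst h1 h2 <;> first
        | exact h4.symm
        | exact absurd h3 (by first | assumption | exact Ne.symm (by assumption))

/-- Graphs without independent quadruples: the bound on the number of edges. -/
theorem card_sq_le_of_no_indep_four (h : NoFiveDissociated G) (m : ℕ) :
    ∀ W : Finset V, W.card = m →
    (∀ a ∈ W, ∀ b ∈ W, ∀ c ∈ W, ∀ d ∈ W, a ≠ b → a ≠ c → a ≠ d → b ≠ c → b ≠ d → c ≠ d →
      ¬ G.Adj a b → ¬ G.Adj a c → ¬ G.Adj a d → ¬ G.Adj b c → ¬ G.Adj b d → ¬ G.Adj c d → False) →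
    (W.card : ℤ) ^ 2 ≤ 2 * adjCount G W W + 3 * W.card := by
  classical
  induction m using Nat.strong_induction_on with
  | _ m ih =>
  intro W hW hI
  -- The induction deletes a set `S`: `step` bounds the edges left over, and `cross` bounds those
  -- between `S` and the rest, which enter the final inequality with weight `4`.
  have step : ∀ S ⊆ W, S.Nonempty →
      ((W.card : ℤ) - S.card) ^ 2 ≤
        2 * adjCount G (W \ S) (W \ S) + 3 * ((W.card : ℤ) - S.card) := by
    intro S hS hne
    have hcard : ((W \ S).card : ℤ) = W.card - S.card := by
      rw [Finset.card_sdiff_of_subset hS, Nat.cast_sub (Finset.card_le_card hS)]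
    have hlt : (W \ S).card < m := by
      have := Finset.card_pos.2 hne
      rw [Finset.card_sdiff_of_subset hS]
      have := Finset.card_le_card hS
      omega
    have := ih _ hlt (W \ S) rfl fun a ha b hb c hc d hd =>
      hI a (Finset.sdiff_subset ha) b (Finset.sdiff_subset hb) c (Finset.sdiff_subset hc) d
        (Finset.sdiff_subset hd)
    rwa [hcard] at this
  have cross : ∀ S ⊆ W, ∀ k : ℤ, (∀ v ∈ W, v ∉ S → k ≤ ∑ y ∈ S, adjInd G v y) →
      k * ((W.card : ℤ) - S.card) ≤ adjCount G (W \ S) S := by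
    intro S hS k hk
    have hcard : ((W \ S).card : ℤ) = W.card - S.card := by
      rw [Finset.card_sdiff_of_subset hS, Nat.cast_sub (Finset.card_le_card hS)]
    have := Finset.card_nsmul_le_sum (W \ S) (fun v => ∑ y ∈ S, adjInd G v y) k
      fun v hv => hk v (Finset.mem_sdiff.1 hv).1 (Finset.mem_sdiff.1 hv).2
    rw [nsmul_eq_mul, hcard] at this
    unfold adjCount
    linarith
  by_cases hpair : ∃ x ∈ W, ∃ y ∈ W, x ≠ y ∧ ¬ G.Adj x y
  swap
  · push Not at hpair
    have : ∀ x ∈ W, ∑ y ∈ W, adjInd G x y = W.card - 1 := by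
      intro x hx
      rw [← Finset.add_sum_erase W _ hx, Finset.sum_congr rfl (g := fun _ => 1)]
      · simp [adjInd, Finset.card_erase_of_mem hx]
        rw [Nat.cast_sub (Finset.card_pos.2 ⟨x, hx⟩)]; simp
      · intro y hy
        exact adjInd_of_adj (hpair x hx y (Finset.mem_of_mem_erase hy)
          (Finset.ne_of_mem_erase hy).symm)
    have : adjCount G W W = W.card * ((W.card : ℤ) - 1) := by
      unfold adjCount; rw [Finset.sum_congr rfl this]; simp [mul_sub]
    rw [this]
    rcases Nat.eq_zero_or_pos W.card with h0 | h0
    · simp [h0]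
    · have : (1 : ℤ) ≤ W.card := by exact_mod_cast h0
      nlinarith
  obtain ⟨x, hx, y, hy, hxy, nxy⟩ := hpair
  by_cases htri : ∃ z ∈ W, z ≠ x ∧ z ≠ y ∧ ¬ G.Adj z x ∧ ¬ G.Adj z y
  swap
  -- Every other vertex sees `x` or `y`, so deleting the pair destroys at least `|W| - 2` edges,
  -- enough for the induction.
  · push Not at htri
    have hS : ({x, y} : Finset V) ⊆ W := by
      intro v hv; simp at hv; rcases hv with rfl | rfl <;> assumption
    have h1 := step {x, y} hS (by simp)
    have h2 := cross {x, y} hS 1 (by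
      intro v hv hvS
      simp only [Finset.mem_insert, Finset.mem_singleton, not_or] at hvS
      rw [Finset.sum_pair hxy]
      have := adjInd_nonneg (G := G) v x
      have := adjInd_nonneg (G := G) v y
      by_cases hvx : G.Adj v x
      · rw [adjInd_of_adj hvx]; linarith
      · rw [adjInd_of_adj (htri v hv hvS.1 hvS.2 hvx)]; linarith)
    have h3 := adjCount_split (G := G) hS
    have h4 := adjCount_nonneg (G := G) {x, y} {x, y}
    rw [Finset.card_pair hxy] at h1 h2
    push_cast at h1 h2
    nlinarith
  obtain ⟨z, hz, hzx, hzy, nzx, nzy⟩ := htri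
  have hS : ({x, y, z} : Finset V) ⊆ W := by
    intro v hv; simp at hv; rcases hv with rfl | rfl | rfl <;> assumption
  have hScard : ({x, y, z} : Finset V).card = 3 := by
    rw [Finset.card_insert_of_notMem, Finset.card_pair hzy.symm]
    simp [hxy, hzx.symm]
  have hsum : ∀ v, ∑ u ∈ ({x, y, z} : Finset V), adjInd G v u
      = adjInd G v x + adjInd G v y + adjInd G v z := by
    intro v
    rw [Finset.sum_insert (by simp [hxy, hzx.symm]), Finset.sum_pair hzy.symm]; ring
  set T := (W \ {x, y, z}).filter fun v => ∑ u ∈ ({x, y, z} : Finset V), adjInd G v u = 1 with hT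
  have hone : ∀ v ∈ W, v ∉ ({x, y, z} : Finset V) →
      1 ≤ ∑ u ∈ ({x, y, z} : Finset V), adjInd G v u := by
    intro v hv hvS
    simp only [Finset.mem_insert, Finset.mem_singleton, not_or] at hvS
    rw [hsum]
    by_contra hlt
    have h1 := adjInd_nonneg (G := G) v x
    have h2 := adjInd_nonneg (G := G) v y
    have h3 := adjInd_nonneg (G := G) v z
    have e1 : ¬ G.Adj v x := adjInd_eq_zero_iff.1 (by linarith)
    have e2 : ¬ G.Adj v y := adjInd_eq_zero_iff.1 (by linarith)
    have e3 : ¬ G.Adj v z := adjInd_eq_zero_iff.1 (by linarith)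
    exact hI v hv x hx y hy z hz hvS.1 hvS.2.1 hvS.2.2 hxy hzx.symm hzy.symm e1 e2 e3 nxy
      (fun h => nzx h.symm) (fun h => nzy h.symm)
  have hTW : T ⊆ W \ {x, y, z} := Finset.filter_subset _ _
  -- a vertex of `T` has exactly one neighbour in the triple
  have hTcases : ∀ v ∈ T, (G.Adj v x ∧ ¬ G.Adj v y ∧ ¬ G.Adj v z) ∨
      (¬ G.Adj v x ∧ G.Adj v y ∧ ¬ G.Adj v z) ∨ (¬ G.Adj v x ∧ ¬ G.Adj v y ∧ G.Adj v z) := by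
    intro v hv
    have := (Finset.mem_filter.1 hv).2
    rw [hsum] at this
    by_cases h1 : G.Adj v x <;> by_cases h2 : G.Adj v y <;> by_cases h3 : G.Adj v z <;>
      simp [adjInd, h1, h2, h3] at this ⊢
  have nyx : ¬ G.Adj y x := fun h => nxy h.symm
  have nxz : ¬ G.Adj x z := fun h => nzx h.symm
  have nyz : ¬ G.Adj y z := fun h => nzy h.symm
  have same : ∀ v ∈ W, ∀ w ∈ W, v ≠ w → ¬ G.Adj v w → ∀ p ∈ W, ∀ q ∈ W, p ≠ q → ¬ G.Adj p q →
      v ≠ p → v ≠ q → w ≠ p → w ≠ q →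
      ¬ G.Adj v p → ¬ G.Adj v q → ¬ G.Adj w p → ¬ G.Adj w q → False :=
    fun v hv w hw hvw nvw p hp q hq hpq npq h1 h2 h3 h4 n1 n2 n3 n4 =>
      hI v hv w hw p hp q hq hvw h1 h2 h3 h4 hpq nvw n1 n2 n3 n4 npq
  -- Here `v` may see only `p` among `p, q, r`, and `w` only `q`; the pairs `v p`, `w q` and the
  -- isolated vertex `r` would be dissociated.
  have diff : ∀ v w, v ≠ w → ¬ G.Adj v w → ∀ p q r, p ≠ q → p ≠ r → q ≠ r → ¬ G.Adj p q →
      ¬ G.Adj p r → ¬ G.Adj q r → v ≠ p → v ≠ q → v ≠ r → w ≠ p → w ≠ q → w ≠ r →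
      ¬ G.Adj v q → ¬ G.Adj v r → ¬ G.Adj w p → ¬ G.Adj w r → False :=
    fun v w hvw nvw p q r hpq hpr hqr npq npr nqr h1 h2 h3 h4 h5 h6 n1 n2 n3 n4 =>
      h.false_of_two_pairs (p := v) (q := p) (r := w) (s := q) (t := r) h1 hvw h2 h3 h4.symm hpq
        hpr h5 h6 hqr nvw n1 n2 (fun h => n3 h.symm) npq npr n4 nqr
  have hTclique : ∀ v ∈ T, ∀ w ∈ T, v ≠ w → G.Adj v w := by
    intro v hv w hw hvw
    by_contra nvw
    have hvW := Finset.mem_sdiff.1 (hTW hv)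
    have hwW := Finset.mem_sdiff.1 (hTW hw)
    simp only [Finset.mem_insert, Finset.mem_singleton, not_or] at hvW hwW
    obtain ⟨hvW, vx, vy, vz⟩ := hvW
    obtain ⟨hwW, wx, wy, wz⟩ := hwW
    rcases hTcases v hv with ⟨v1, v2, v3⟩ | ⟨v1, v2, v3⟩ | ⟨v1, v2, v3⟩ <;>
      rcases hTcases w hw with ⟨w1, w2, w3⟩ | ⟨w1, w2, w3⟩ | ⟨w1, w2, w3⟩
    · exact same v hvW w hwW hvw nvw y hy z hz hzy.symm nyz vy vz wy wz v2 v3 w2 w3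
    · exact diff v w hvw nvw x y z hxy hzx.symm hzy.symm nxy nxz nyz vx vy vz wx wy wz v2 v3 w1 w3
    · exact diff v w hvw nvw x z y hzx.symm hxy hzy nxz nxy nzy vx vz vy wx wz wy v3 v2 w1 w2
    · exact diff v w hvw nvw y x z hxy.symm hzy.symm hzx.symm nyx nyz nxz vy vx vz wy wx wz v1 v3
        w2 w3
    · exact same v hvW w hwW hvw nvw x hx z hz hzx.symm nxz vx vz wx wz v1 v3 w1 w3
    · exact diff v w hvw nvw y z x hzy.symm hxy.symm hzx nyz nyx nzx vy vz vx wy wz wx v3 v1 w2 w1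
    · exact diff v w hvw nvw z x y hzx hzy hxy nzx nzy nxy vz vx vy wz wx wy v1 v2 w3 w2
    · exact diff v w hvw nvw z y x hzy hzx hxy.symm nzy nzx nyx vz vy vx wz wy wx v2 v1 w3 w1
    · exact same v hvW w hwW hvw nvw x hx y hy hxy nxy vx vy wx wy v1 v2 w1 w2
  have hWcard : ((W \ {x, y, z}).card : ℤ) = W.card - 3 := by
    rw [Finset.card_sdiff_of_subset hS, Nat.cast_sub (Finset.card_le_card hS), hScard]; rfl
  -- If `T` is at most half of the remaining vertices, the triple sends out at least `3 * (|W| - 3)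
  -- / 2` edges, exactly what deleting it requires.
  by_cases ht : 2 * (T.card : ℤ) ≤ W.card - 3
  · have h1 := step {x, y, z} hS (by simp)
    have h2 : 2 * ((W.card : ℤ) - 3) - T.card ≤ adjCount G (W \ {x, y, z}) {x, y, z} := by
      have hT1 : ∑ v ∈ W \ {x, y, z}, (2 - if ∑ u ∈ ({x, y, z} : Finset V), adjInd G v u = 1
          then (1 : ℤ) else 0) ≤ adjCount G (W \ {x, y, z}) {x, y, z} := by
        refine Finset.sum_le_sum fun v hv => ?_
        have := hone v (Finset.mem_sdiff.1 hv).1 (Finset.mem_sdiff.1 hv).2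
        split_ifs with hif
        · omega
        · omega
      rw [Finset.sum_sub_distrib, Finset.sum_const, nsmul_eq_mul, hWcard, Finset.sum_boole,
        ← hT] at hT1
      linarith
    have h3 := adjCount_split (G := G) hS
    have h4 := adjCount_nonneg (G := G) {x, y, z} {x, y, z}
    rw [hScard] at h1
    push_cast at h1
    nlinarith
  -- If `T` is large, a single vertex of this clique is deleted: it has `|T| - 1` neighbours in `T`
  -- and one in the triple, and `2 * |T| ≥ |W| - 2` is exactly enough.
  · have hTne : T.Nonempty := by
      rw [Finset.nonempty_iff_ne_empty]
      intro h0
      have : (3 : ℤ) ≤ W.card := by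
        have := Finset.card_le_card hS
        rw [hScard] at this
        exact_mod_cast this
      rw [h0] at ht
      simp at ht
      linarith
    obtain ⟨v, hv⟩ := hTne
    have hvS := Finset.mem_sdiff.1 (hTW hv)
    have hS' : ({v} : Finset V) ⊆ W := by simpa using hvS.1
    have h1 := step {v} hS' (by simp)
    have h3 := adjCount_split (G := G) hS'
    have h2 : (T.card : ℤ) ≤ adjCount G (W \ {v}) {v} := by
      rw [adjCount_comm]
      have e : adjCount G {v} (W \ {v}) = ∑ y ∈ W \ {v}, adjInd G v y := by simp [adjCount]
      rw [e]
      have hsub : (T.erase v) ∪ {x, y, z} ⊆ W \ {v} := by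
        intro u hu
        rcases Finset.mem_union.1 hu with hu | hu
        · have := Finset.mem_sdiff.1 (hTW (Finset.mem_of_mem_erase hu))
          simpa [this.1] using Finset.ne_of_mem_erase hu
        · refine Finset.mem_sdiff.2 ⟨hS hu, ?_⟩
          intro h
          rw [Finset.mem_singleton] at h
          exact hvS.2 (h ▸ hu)
      have hdis : Disjoint (T.erase v) {x, y, z} := by
        refine Finset.disjoint_left.2 fun u hu hu' => ?_
        exact (Finset.mem_sdiff.1 (hTW (Finset.mem_of_mem_erase hu))).2 hu'
      have := Finset.sum_le_sum_of_subset_of_nonneg (f := fun y => adjInd G v y) hsub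
        fun i _ _ => adjInd_nonneg _ _
      rw [Finset.sum_union hdis, (Finset.mem_filter.1 hv).2, Finset.sum_congr rfl
        (g := fun _ => (1 : ℤ)) fun w hw => adjInd_of_adj (hTclique v hv w
          (Finset.mem_of_mem_erase hw) (Finset.ne_of_mem_erase hw).symm)] at this
      rw [Finset.sum_const, Finset.card_erase_of_mem hv, nsmul_eq_mul,
        Nat.cast_sub (Finset.card_pos.2 ⟨v, hv⟩)] at this
      push_cast at this
      linarith
    rw [adjCount_singleton_self] at h3
    rw [Finset.card_singleton] at h1
    push_cast at h1
    have : (W.card : ℤ) - 2 ≤ 2 * T.card := by omega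
    nlinarith

end Combinatorics

/-! ### Independent quadruples and the pairing they carry -/

section Structure

variable {V : Type*} {G : SimpleGraph V}

/-- Four distinct, pairwise non-adjacent vertices. -/
structure IndepFour (G : SimpleGraph V) (a b c d : V) : Prop where
  ab : a ≠ b
  ac : a ≠ c
  ad : a ≠ d
  bc : b ≠ c
  bd : b ≠ d
  cd : c ≠ d
  nab : ¬ G.Adj a b
  nac : ¬ G.Adj a c
  nad : ¬ G.Adj a d
  nbc : ¬ G.Adj b c
  nbd : ¬ G.Adj b d
  ncd : ¬ G.Adj c d

/-- The number of neighbours of `v` among `a, b, c, d`. -/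
noncomputable def fourCount (G : SimpleGraph V) (a b c d v : V) : ℤ :=
  adjInd G v a + adjInd G v b + adjInd G v c + adjInd G v d

namespace IndepFour

variable {a b c d : V}

lemma swap_ab (h : IndepFour G a b c d) : IndepFour G b a c d :=
  ⟨h.ab.symm, h.bc, h.bd, h.ac, h.ad, h.cd, fun e => h.nab e.symm, h.nbc, h.nbd, h.nac, h.nad,
    h.ncd⟩

lemma swap_bc (h : IndepFour G a b c d) : IndepFour G a c b d :=
  ⟨h.ac, h.ab, h.ad, h.bc.symm, h.cd, h.bd, h.nac, h.nab, h.nad, fun e => h.nbc e.symm, h.ncd,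
    h.nbd⟩

lemma swap_cd (h : IndepFour G a b c d) : IndepFour G a b d c :=
  ⟨h.ab, h.ad, h.ac, h.bd, h.bc, h.cd.symm, h.nab, h.nad, h.nac, h.nbd, h.nbc,
    fun e => h.ncd e.symm⟩

lemma swap_pairs (h : IndepFour G a b c d) : IndepFour G c d a b :=
  h.swap_bc.swap_ab.swap_cd.swap_bc

lemma sum_eq [DecidableEq V] (h : IndepFour G a b c d) (v : V) :
    ∑ u ∈ ({a, b, c, d} : Finset V), adjInd G v u = fourCount G a b c d v := by
  rw [Finset.sum_insert (by simp [h.ab, h.ac, h.ad]), Finset.sum_insert (by simp [h.bc, h.bd]),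
    Finset.sum_pair h.cd, fourCount]
  ring

lemma card_eq [DecidableEq V] (h : IndepFour G a b c d) :
    ({a, b, c, d} : Finset V).card = 4 := by
  rw [Finset.card_insert_of_notMem (by simp [h.ab, h.ac, h.ad]),
    Finset.card_insert_of_notMem (by simp [h.bc, h.bd]), Finset.card_pair h.cd]

lemma adjCount_eq_zero [DecidableEq V] (h : IndepFour G a b c d) :
    adjCount G {a, b, c, d} {a, b, c, d} = 0 := by
  have n1 := h.nab; have n2 := h.nac; have n3 := h.nad; have n4 := h.nbc; have n5 := h.nbd
  have n6 := h.ncd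
  have m1 : ¬ G.Adj b a := fun e => n1 e.symm
  have m2 : ¬ G.Adj c a := fun e => n2 e.symm
  have m3 : ¬ G.Adj d a := fun e => n3 e.symm
  have m4 : ¬ G.Adj c b := fun e => n4 e.symm
  have m5 : ¬ G.Adj d b := fun e => n5 e.symm
  have m6 : ¬ G.Adj d c := fun e => n6 e.symm
  unfold adjCount
  refine Finset.sum_eq_zero fun x hx => ?_
  rw [h.sum_eq, fourCount]
  simp only [Finset.mem_insert, Finset.mem_singleton] at hx
  rcases hx with rfl | rfl | rfl | rfl <;>
    simp [adjInd, n1, n2, n3, n4, n5, n6, m1, m2, m3, m4, m5, m6]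

/-- Two non-adjacent vertices with exactly one common neighbour `a` and each with at most one other
neighbour in the quadruple do not exist. -/
lemma adj_of_not_adj (h : IndepFour G a b c d) (hG : NoFiveDissociated G) {v w : V} (hvw : v ≠ w)
    (hv : v ≠ a ∧ v ≠ b ∧ v ≠ c ∧ v ≠ d) (hw : w ≠ a ∧ w ≠ b ∧ w ≠ c ∧ w ≠ d)
    (v1 : ¬ G.Adj v c) (v2 : ¬ G.Adj v d) (w1 : ¬ G.Adj w b) (w2 : ¬ G.Adj w d) : G.Adj v w := by
  by_contra n
  exact hG.false_of_two_pairs (p := v) (q := b) (r := w) (s := c) (t := d) hv.2.1 hvw hv.2.2.1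
    hv.2.2.2 hw.2.1.symm h.bc h.bd hw.2.2.1 hw.2.2.2 h.cd n v1 v2 (fun e => w1 e.symm) h.nbc h.nbd
    w2 h.ncd

/-- With at most one neighbour in the quadruple, `v` and the quadruple would be five vertices
spanning at most one edge. -/
lemma two_le_fourCount (h : IndepFour G a b c d) (hG : NoFiveDissociated G) {v : V}
    (hv : v ≠ a ∧ v ≠ b ∧ v ≠ c ∧ v ≠ d) : 2 ≤ fourCount G a b c d v := by
  have key : ∀ {a b c d : V}, IndepFour G a b c d → (v ≠ a ∧ v ≠ b ∧ v ≠ c ∧ v ≠ d) →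
      ¬ G.Adj v b → ¬ G.Adj v c → ¬ G.Adj v d → False := by
    intro a b c d h hv n1 n2 n3
    exact hG.false_of_two_pairs (p := v) (q := a) (r := b) (s := c) (t := d) hv.1 hv.2.1 hv.2.2.1
      hv.2.2.2 h.ab h.ac h.ad h.bc h.bd h.cd n1 n2 n3 h.nab h.nac h.nad h.nbd h.ncd
  have k1 := key h hv
  have k2 := key h.swap_ab ⟨hv.2.1, hv.1, hv.2.2⟩
  have k3 := key h.swap_bc.swap_ab ⟨hv.2.2.1, hv.1, hv.2.1, hv.2.2.2⟩
  have k4 := key h.swap_cd.swap_bc.swap_ab ⟨hv.2.2.2, hv.1, hv.2.1, hv.2.2.1⟩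
  by_cases e1 : G.Adj v a <;> by_cases e2 : G.Adj v b <;> by_cases e3 : G.Adj v c <;>
    by_cases e4 : G.Adj v d <;> simp [fourCount, adjInd, e1, e2, e3, e4] at k1 k2 k3 k4 ⊢

end IndepFour

/-- An independent quadruple sends at least two edges to each outside vertex, and deleting it
reproduces the bound with equality. Without such a quadruple the stronger bound with `3` in place of
`4` holds. -/
theorem card_sq_le (hG : NoFiveDissociated G) (m : ℕ) :
    ∀ W : Finset V, W.card = m → (W.card : ℤ) ^ 2 ≤ 2 * adjCount G W W + 4 * W.card := by
  classical
  induction m using Nat.strong_induction_on with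
  | _ m ih =>
  intro W hW
  by_cases hI : ∃ a ∈ W, ∃ b ∈ W, ∃ c ∈ W, ∃ d ∈ W, IndepFour G a b c d
  · obtain ⟨a, ha, b, hb, c, hc, d, hd, h⟩ := hI
    have hS : ({a, b, c, d} : Finset V) ⊆ W := by
      intro v hv; simp at hv; rcases hv with rfl | rfl | rfl | rfl <;> assumption
    have hcard : ((W \ {a, b, c, d}).card : ℤ) = W.card - 4 := by
      rw [Finset.card_sdiff_of_subset hS, Nat.cast_sub (Finset.card_le_card hS), h.card_eq]; rfl
    have h1 := ih (W \ {a, b, c, d}).card (by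
      rw [Finset.card_sdiff_of_subset hS, h.card_eq]
      have := Finset.card_le_card hS
      rw [h.card_eq] at this
      omega) _ rfl
    have h2 := Finset.card_nsmul_le_sum (W \ {a, b, c, d})
      (fun v => ∑ y ∈ {a, b, c, d}, adjInd G v y) 2 fun v hv => by
        rw [h.sum_eq]
        have := (Finset.mem_sdiff.1 hv).2
        simp only [Finset.mem_insert, Finset.mem_singleton, not_or] at this
        exact h.two_le_fourCount hG this
    have h3 := adjCount_split (G := G) hS
    rw [h.adjCount_eq_zero] at h3
    change _ ≤ adjCount G (W \ {a, b, c, d}) {a, b, c, d} at h2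
    rw [nsmul_eq_mul, hcard] at h2
    rw [hcard] at h1
    nlinarith
  · have := card_sq_le_of_no_indep_four hG m W hW
      fun a ha b hb c hc d hd h1 h2 h3 h4 h5 h6 n1 n2 n3 n4 n5 n6 =>
        hI ⟨a, ha, b, hb, c, hc, d, hd, h1, h2, h3, h4, h5, h6, n1, n2, n3, n4, n5, n6⟩
    have : (0 : ℤ) ≤ W.card := by positivity
    linarith

lemma card_sub_one_le_sum_adjInd {T : Finset V} {x : V}
    (h : ∀ y ∈ T, ∀ z ∈ T, ¬ G.Adj x y → ¬ G.Adj x z → y = z) :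
    (T.card : ℤ) - 1 ≤ ∑ y ∈ T, adjInd G x y := by
  have h1 : (T.filter fun y => adjInd G x y = 0).card ≤ 1 := by
    refine Finset.card_le_one.2 fun y hy z hz => ?_
    rw [Finset.mem_filter, adjInd_eq_zero_iff] at hy hz
    exact h y hy.1 z hz.1 hy.2 hz.2
  have h2 : ∑ y ∈ T, (1 - if adjInd G x y = 0 then (1 : ℤ) else 0) ≤ ∑ y ∈ T, adjInd G x y := by
    refine Finset.sum_le_sum fun y _ => ?_
    have := adjInd_nonneg (G := G) x y
    split_ifs <;> omega
  rw [Finset.sum_sub_distrib, Finset.sum_boole, Finset.sum_const, nsmul_eq_mul] at h2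
  have : ((T.filter fun y => adjInd G x y = 0).card : ℤ) ≤ 1 := by exact_mod_cast h1
  linarith

lemma NearComplete.le_sum [DecidableEq V] {A : Finset V} (hA : NearComplete G A) {x : V}
    (hx : x ∈ A) : (A.card : ℤ) - 2 ≤ ∑ y ∈ A, adjInd G x y := by
  have h := card_sub_one_le_sum_adjInd (G := G) (T := A.erase x) (x := x) fun y hy z hz =>
    hA x hx y (Finset.mem_of_mem_erase hy) z (Finset.mem_of_mem_erase hz)
      (Finset.ne_of_mem_erase hy).symm (Finset.ne_of_mem_erase hz).symm
  rw [Finset.card_erase_of_mem hx, Nat.cast_sub (Finset.card_pos.2 ⟨x, hx⟩)] at h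
  rw [← Finset.add_sum_erase A _ hx, adjInd_of_not_adj G.irrefl]
  push_cast at h
  linarith

lemma NearComplete.le_adjCount [DecidableEq V] {A : Finset V} (hA : NearComplete G A) :
    (A.card : ℤ) ^ 2 - 2 * A.card ≤ adjCount G A A := by
  have := Finset.card_nsmul_le_sum A (fun x => ∑ y ∈ A, adjInd G x y) _ fun x hx => hA.le_sum hx
  rw [nsmul_eq_mul] at this
  unfold adjCount
  linarith

/-- A complete join beats `card_sq_le` by `2 * |Y| * |Z|`, far more than the slack of a graph with
few edges; this excludes mixed pairings of a quadruple. -/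
lemma card_sq_le_of_joined [DecidableEq V] (hG : NoFiveDissociated G) {Y Z : Finset V}
    (hd : Disjoint Y Z) (hj : ∀ y ∈ Y, ∀ z ∈ Z, G.Adj y z) :
    ((Y.card : ℤ) + Z.card) ^ 2 - 4 * (Y.card + Z.card) + 2 * (Y.card * Z.card) ≤
      2 * adjCount G (Y ∪ Z) (Y ∪ Z) := by
  have h1 := card_sq_le hG _ Y rfl
  have h2 := card_sq_le hG _ Z rfl
  have h3 : adjCount G Y Z = Y.card * Z.card := by
    unfold adjCount
    rw [Finset.sum_congr rfl fun y hy => Finset.sum_congr rfl fun z hz =>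
      adjInd_of_adj (hj y hy z hz)]
    simp
  rw [adjCount_union_self hd, h3]
  linarith

/-- In a graph with few edges, an independent quadruple splits into two pairs so that all but at
most one outside vertices are adjacent to exactly the vertices of one of the pairs. -/
theorem exists_pairing [Fintype V] (hG : NoFiveDissociated G) (hn : 8 ≤ Fintype.card V)
    (hE : 2 * adjCount G Finset.univ Finset.univ ≤
      (Fintype.card V : ℤ) ^ 2 - 4 * Fintype.card V + 4) :
    ∃ a b c d, IndepFour G a b c d ∧ ∃ v₀,
      (∀ v, (v ≠ a ∧ v ≠ b ∧ v ≠ c ∧ v ≠ d) → v ≠ v₀ →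
        (G.Adj v a ∧ G.Adj v b ∧ ¬ G.Adj v c ∧ ¬ G.Adj v d) ∨
        (¬ G.Adj v a ∧ ¬ G.Adj v b ∧ G.Adj v c ∧ G.Adj v d)) ∧
      ((v₀ ≠ a ∧ v₀ ≠ b ∧ v₀ ≠ c ∧ v₀ ≠ d) →
        (G.Adj v₀ a ∧ G.Adj v₀ b ∧ ¬ (G.Adj v₀ c ∧ G.Adj v₀ d)) ∨
        (¬ (G.Adj v₀ a ∧ G.Adj v₀ b) ∧ G.Adj v₀ c ∧ G.Adj v₀ d)) := by
  classical
  have hn' : (8 : ℤ) ≤ Fintype.card V := by exact_mod_cast hn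
  by_cases hI : ∃ a b c d, IndepFour G a b c d
  swap
  · exfalso
    have := card_sq_le_of_no_indep_four hG _ Finset.univ rfl
      fun a ha b hb c hc d hd h1 h2 h3 h4 h5 h6 n1 n2 n3 n4 n5 n6 =>
        hI ⟨a, b, c, d, h1, h2, h3, h4, h5, h6, n1, n2, n3, n4, n5, n6⟩
    rw [Finset.card_univ] at this
    linarith
  obtain ⟨a, b, c, d, h⟩ := hI
  -- the vertices outside the quadruple and those with two neighbours in it
  have main : ∀ {a b c d : V}, IndepFour G a b c d →
      (∑ v ∈ Finset.univ \ {a, b, c, d}, (fourCount G a b c d v - 2) ≤ 1) ∧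
      2 * adjCount G (Finset.univ \ {a, b, c, d}) (Finset.univ \ {a, b, c, d}) +
        4 * ∑ v ∈ Finset.univ \ {a, b, c, d}, (fourCount G a b c d v - 2) ≤
        ((Fintype.card V : ℤ) - 4) ^ 2 - 4 * ((Fintype.card V : ℤ) - 4) + 4 := by
    intro a b c d h
    have hS : ({a, b, c, d} : Finset V) ⊆ Finset.univ := Finset.subset_univ _
    have hcard : ((Finset.univ \ {a, b, c, d} : Finset V).card : ℤ) = Fintype.card V - 4 := by
      rw [Finset.card_sdiff_of_subset hS, Nat.cast_sub (Finset.card_le_card hS), h.card_eq,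
        Finset.card_univ]; rfl
    have h1 := card_sq_le hG _ (Finset.univ \ {a, b, c, d}) rfl
    have h3 := adjCount_split (G := G) hS
    rw [h.adjCount_eq_zero] at h3
    have h4 : adjCount G (Finset.univ \ {a, b, c, d}) {a, b, c, d} =
        ∑ v ∈ Finset.univ \ {a, b, c, d}, fourCount G a b c d v :=
      Finset.sum_congr rfl fun v _ => h.sum_eq v
    rw [Finset.sum_sub_distrib, Finset.sum_const, nsmul_eq_mul, hcard]
    rw [hcard] at h1
    constructor
    · by_contra hlt
      have : 2 ≤ ∑ x ∈ Finset.univ \ {a, b, c, d}, fourCount G a b c d x -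
          ((Fintype.card V : ℤ) - 4) * 2 := by omega
      nlinarith
    · nlinarith
  have hcard : ∀ {a b c d : V}, IndepFour G a b c d →
      ((Finset.univ \ {a, b, c, d} : Finset V).card : ℤ) = Fintype.card V - 4 := by
    intro a b c d h
    have hS : ({a, b, c, d} : Finset V) ⊆ Finset.univ := Finset.subset_univ _
    rw [Finset.card_sdiff_of_subset hS, Nat.cast_sub (Finset.card_le_card hS), h.card_eq,
      Finset.card_univ]; rfl
  have hmem : ∀ {a b c d v : V}, v ∈ Finset.univ \ ({a, b, c, d} : Finset V) ↔
      (v ≠ a ∧ v ≠ b ∧ v ≠ c ∧ v ≠ d) := by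
    intro a b c d v
    simp
  -- The total excess over two neighbours per outside vertex is at most one, so at most one vertex
  -- `v₀` is exceptional, and it has three.
  have hex : ∀ {a b c d : V}, IndepFour G a b c d → ∃ v₀, ∀ v,
      (v ≠ a ∧ v ≠ b ∧ v ≠ c ∧ v ≠ d) → (v ≠ v₀ → fourCount G a b c d v = 2) ∧
        fourCount G a b c d v ≤ 3 := by
    intro a b c d h
    have hs := (main h).1
    have hnn : ∀ v ∈ Finset.univ \ ({a, b, c, d} : Finset V), 0 ≤ fourCount G a b c d v - 2 :=
      fun v hv => by have := h.two_le_fourCount hG (hmem.1 hv); linarith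
    have hle : ∀ v, (v ≠ a ∧ v ≠ b ∧ v ≠ c ∧ v ≠ d) → fourCount G a b c d v ≤ 3 := by
      intro v hv
      have := Finset.single_le_sum hnn (hmem.2 hv)
      linarith
    by_cases h3 : ∃ v, (v ≠ a ∧ v ≠ b ∧ v ≠ c ∧ v ≠ d) ∧ fourCount G a b c d v ≠ 2
    · obtain ⟨v₀, hv₀, h2⟩ := h3
      refine ⟨v₀, fun v hv => ⟨fun hne => ?_, hle v hv⟩⟩
      have e1 := h.two_le_fourCount hG hv₀
      have e2 := h.two_le_fourCount hG hv
      have := Finset.sum_le_sum_of_subset_of_nonneg (f := fun v => fourCount G a b c d v - 2)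
        (s := {v, v₀}) (t := Finset.univ \ {a, b, c, d}) (by
          intro x hx
          simp only [Finset.mem_insert, Finset.mem_singleton] at hx
          rcases hx with rfl | rfl
          · exact hmem.2 hv
          · exact hmem.2 hv₀) fun i hi _ => hnn i hi
      rw [Finset.sum_pair hne] at this
      omega
    · push Not at h3
      exact ⟨a, fun v hv => ⟨fun _ => h3 v hv, hle v hv⟩⟩
  -- relabel so that some outside vertex is adjacent to `a` and `b` only
  obtain ⟨a, b, c, d, h, v₁, hv₁, hva, hvb, hvc, hvd⟩ : ∃ a b c d, IndepFour G a b c d ∧ ∃ v₁,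
      (v₁ ≠ a ∧ v₁ ≠ b ∧ v₁ ≠ c ∧ v₁ ≠ d) ∧ G.Adj v₁ a ∧ G.Adj v₁ b ∧ ¬ G.Adj v₁ c ∧
        ¬ G.Adj v₁ d := by
    obtain ⟨v₀, hv₀⟩ := hex h
    have : 1 < (Finset.univ \ {a, b, c, d} : Finset V).card := by
      have := hcard h
      omega
    obtain ⟨v, hv, hne⟩ := Finset.exists_mem_ne this v₀
    rw [hmem] at hv
    have h2 := (hv₀ v hv).1 hne
    obtain ⟨va, vb, vc, vd⟩ := hv
    by_cases e1 : G.Adj v a <;> by_cases e2 : G.Adj v b <;> by_cases e3 : G.Adj v c <;>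
      by_cases e4 : G.Adj v d <;> simp [fourCount, adjInd, e1, e2, e3, e4] at h2
    · exact ⟨a, b, c, d, h, v, ⟨va, vb, vc, vd⟩, e1, e2, e3, e4⟩
    · exact ⟨a, c, b, d, h.swap_bc, v, ⟨va, vc, vb, vd⟩, e1, e3, e2, e4⟩
    · exact ⟨a, d, b, c, h.swap_cd.swap_bc, v, ⟨va, vd, vb, vc⟩, e1, e4, e2, e3⟩
    · exact ⟨b, c, a, d, h.swap_ab.swap_bc, v, ⟨vb, vc, va, vd⟩, e2, e3, e1, e4⟩
    · exact ⟨b, d, a, c, h.swap_cd.swap_ab.swap_bc, v, ⟨vb, vd, va, vc⟩, e2, e4, e1, e3⟩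
    · exact ⟨c, d, a, b, h.swap_pairs, v, ⟨vc, vd, va, vb⟩, e3, e4, e1, e2⟩
  obtain ⟨v₀, hv₀⟩ := hex h
  obtain ⟨hm1, hm2⟩ := main h
  set U : Finset V := Finset.univ \ {a, b, c, d} with hU
  -- `Y` collects the vertices whose two neighbours form one of the pairs `a b`, `c d`; those in `Z`
  -- take one neighbour from each pair. A vertex of `Y` and one of `Z` share exactly one neighbour,
  -- which forces them to be adjacent.
  set Y := U.filter fun v => fourCount G a b c d v = 2 ∧ adjInd G v a = adjInd G v b with hY
  set Z := U.filter fun v => fourCount G a b c d v = 2 ∧ adjInd G v a ≠ adjInd G v b with hZ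
  have hYZ : Disjoint Y Z := by
    refine Finset.disjoint_left.2 fun v h1 h2 => ?_
    exact (Finset.mem_filter.1 h2).2.2 (Finset.mem_filter.1 h1).2.2
  have hjoin : ∀ y ∈ Y, ∀ z ∈ Z, G.Adj y z := by
    intro y hy z hz
    have hyz : y ≠ z := fun e => Finset.disjoint_left.1 hYZ hy (e ▸ hz)
    obtain ⟨hyU, hy2, hy3⟩ := Finset.mem_filter.1 hy
    obtain ⟨hzU, hz2, hz3⟩ := Finset.mem_filter.1 hz
    obtain ⟨ya, yb, yc, yd⟩ := hmem.1 hyU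
    obtain ⟨za, zb, zc, zd⟩ := hmem.1 hzU
    by_cases y1 : G.Adj y a <;> by_cases y2 : G.Adj y b <;> by_cases y3 : G.Adj y c <;>
      by_cases y4 : G.Adj y d <;>
      simp [fourCount, adjInd, y1, y2, y3, y4] at hy2 hy3 <;>
      by_cases z1 : G.Adj z a <;> by_cases z2 : G.Adj z b <;> by_cases z3 : G.Adj z c <;>
      by_cases z4 : G.Adj z d <;>
      simp [fourCount, adjInd, z1, z2, z3, z4] at hz2 hz3
    · exact h.adj_of_not_adj hG hyz ⟨ya, yb, yc, yd⟩ ⟨za, zb, zc, zd⟩ y3 y4 z2 z4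
    · exact h.swap_cd.adj_of_not_adj hG hyz ⟨ya, yb, yd, yc⟩ ⟨za, zb, zd, zc⟩ y4 y3 z2 z3
    · exact h.swap_ab.adj_of_not_adj hG hyz ⟨yb, ya, yc, yd⟩ ⟨zb, za, zc, zd⟩ y3 y4 z1 z4
    · exact h.swap_ab.swap_cd.adj_of_not_adj hG hyz ⟨yb, ya, yd, yc⟩ ⟨zb, za, zd, zc⟩ y4 y3 z1 z3
    · exact h.swap_pairs.adj_of_not_adj hG hyz ⟨yc, yd, ya, yb⟩ ⟨zc, zd, za, zb⟩ y1 y2 z4 z2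
    · exact h.swap_pairs.swap_ab.adj_of_not_adj hG hyz ⟨yd, yc, ya, yb⟩ ⟨zd, zc, za, zb⟩ y1 y2
        z3 z2
    · exact h.swap_pairs.swap_cd.adj_of_not_adj hG hyz ⟨yc, yd, yb, ya⟩ ⟨zc, zd, zb, za⟩ y2 y1
        z4 z1
    · exact h.swap_pairs.swap_ab.swap_cd.adj_of_not_adj hG hyz ⟨yd, yc, yb, ya⟩ ⟨zd, zc, zb, za⟩
        y2 y1 z3 z1
  have hYZU : Y ∪ Z ⊆ U :=
    Finset.union_subset (Finset.filter_subset _ _) (Finset.filter_subset _ _)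
  have hj := card_sq_le_of_joined hG hYZ hjoin
  have hmono := adjCount_mono_self (G := G) hYZU
  have hv₁Y : v₁ ∈ Y := by
    refine Finset.mem_filter.2 ⟨hmem.2 hv₁, ?_, ?_⟩ <;>
      simp [fourCount, adjInd, hva, hvb, hvc, hvd]
  have hYpos : (1 : ℤ) ≤ Y.card := by exact_mod_cast Finset.card_pos.2 ⟨v₁, hv₁Y⟩
  have hcardYZ : (Y.card : ℤ) + Z.card = (U.filter fun v => fourCount G a b c d v = 2).card := by
    have : Y ∪ Z = U.filter fun v => fourCount G a b c d v = 2 := by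
      ext v
      simp only [hY, hZ, Finset.mem_union, Finset.mem_filter]
      tauto
    rw [← this, Finset.card_union_of_disjoint hYZ]; push_cast; ring
  have hsum : (U.card : ℤ) - (U.filter fun v => fourCount G a b c d v = 2).card ≤
      ∑ v ∈ U, (fourCount G a b c d v - 2) := by
    have : ∑ v ∈ U, (1 - if fourCount G a b c d v = 2 then (1 : ℤ) else 0) ≤
        ∑ v ∈ U, (fourCount G a b c d v - 2) := by
      refine Finset.sum_le_sum fun v hv => ?_
      have := h.two_le_fourCount hG (hmem.1 hv)
      split_ifs <;> omega
    rwa [Finset.sum_sub_distrib, Finset.sum_boole, Finset.sum_const, nsmul_eq_mul, mul_one] at this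
  -- Since `Y` contains `v₁`, a nonempty `Z` gives `|Y| * |Z| ≥ |Y| + |Z| - 1`, too many edges for
  -- the join, whether `Y ∪ Z` is all of `U` or misses one vertex. In the second case the excess `s`
  -- is `1`, which tightens `hm2`.
  have hZ0 : Z = ∅ := by
    rw [← Finset.card_eq_zero]
    by_contra hne
    have hZpos : (1 : ℤ) ≤ Z.card := by exact_mod_cast Nat.one_le_iff_ne_zero.2 hne
    have hprod : (Y.card : ℤ) + Z.card - 1 ≤ Y.card * Z.card := by nlinarith
    rw [hcard h] at hsum
    have hle : (Y.card : ℤ) + Z.card ≤ (Fintype.card V : ℤ) - 4 := by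
      rw [← hcard h, hcardYZ]
      exact_mod_cast Finset.card_le_card (Finset.filter_subset _ _)
    generalize (Y.card : ℤ) = y at *
    generalize (Z.card : ℤ) = z at *
    generalize (∑ v ∈ U, (fourCount G a b c d v - 2)) = s at *
    rw [← hcardYZ] at hsum
    rcases (by omega : y + z = (Fintype.card V : ℤ) - 4 ∨
      (y + z = (Fintype.card V : ℤ) - 5 ∧ s = 1)) with e | ⟨e, e'⟩
    · have : (Fintype.card V : ℤ) = y + z + 4 := by linarith
      rw [this] at hm2
      nlinarith
    · have : (Fintype.card V : ℤ) = y + z + 5 := by linarith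
      rw [this, e'] at hm2
      nlinarith
  have heq : ∀ v, (v ≠ a ∧ v ≠ b ∧ v ≠ c ∧ v ≠ d) → fourCount G a b c d v = 2 →
      adjInd G v a = adjInd G v b := by
    intro v hv h2
    by_contra h3
    have : v ∈ Z := Finset.mem_filter.2 ⟨hmem.2 hv, h2, h3⟩
    simp [hZ0] at this
  refine ⟨a, b, c, d, h, v₀, fun v hv hne => ?_, fun hv => ?_⟩
  · have h2 := (hv₀ v hv).1 hne
    have h3 := heq v hv h2
    by_cases y1 : G.Adj v a <;> by_cases y2 : G.Adj v b <;> by_cases y3 : G.Adj v c <;>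
      by_cases y4 : G.Adj v d <;>
      simp [fourCount, adjInd, y1, y2, y3, y4] at h2 h3 ⊢
  · have h2 := (hv₀ v₀ hv).2
    have h3 := heq v₀ hv
    have h4 := h.two_le_fourCount hG hv
    by_cases y1 : G.Adj v₀ a <;> by_cases y2 : G.Adj v₀ b <;> by_cases y3 : G.Adj v₀ c <;>
      by_cases y4 : G.Adj v₀ d <;>
      simp [fourCount, adjInd, y1, y2, y3, y4] at h2 h3 h4 ⊢

end Structure

/-! ### The partition into two near-complete parts, and its rigidity -/

section Partition

variable {V : Type*} {G : SimpleGraph V}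

/-- If `x` misses both `y` and `z`, then `x, c, d` are isolated among `x, y, z, c, d`, and only `y
z` can be an edge. -/
lemma IndepFour.nearComplete_of_not_adj {a b c d : V} (h : IndepFour G a b c d)
    (hG : NoFiveDissociated G) {A : Finset V} (hc : c ∉ A) (hd : d ∉ A)
    (hN : ∀ x ∈ A, ¬ G.Adj x c ∧ ¬ G.Adj x d) : NearComplete G A := by
  intro x hx y hy z hz hxy hxz nxy nxz
  by_contra hyz
  have ne : ∀ {u v : V}, u ∈ A → v ∉ A → u ≠ v := fun hu hv e => hv (e ▸ hu)
  exact hG.false_of_two_pairs (p := y) (q := z) (r := c) (s := d) (t := x) hyz (ne hy hc)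
    (ne hy hd) hxy.symm (ne hz hc) (ne hz hd) hxz.symm h.cd (ne hx hc).symm (ne hx hd).symm
    (hN y hy).1 (hN y hy).2 (fun e => nxy e.symm) (hN z hz).1 (hN z hz).2 (fun e => nxz e.symm)
    (fun e => (hN x hx).1 e.symm) (fun e => (hN x hx).2 e.symm)

/-- A count excluding an induced path through an exceptional vertex `v₀`. -/
lemma false_of_exceptional [Fintype V] [DecidableEq V] (hn : 8 ≤ Fintype.card V)
    (hE : 2 * adjCount G Finset.univ Finset.univ ≤
      (Fintype.card V : ℤ) ^ 2 - 4 * Fintype.card V + 4)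
    {A : Finset V} {v₀ x z d : V} (h0 : v₀ ∈ A) (hx : x ∈ A) (hz : z ∈ A) (hx0 : x ≠ v₀)
    (hz0 : z ≠ v₀) (hxz : x ≠ z) (hd : d ∉ A) (hA : NearComplete G (A.erase v₀))
    (hB : NearComplete G Aᶜ)
    (hc : ∀ y ∈ A.erase v₀, ∀ z ∈ A.erase v₀, ¬ G.Adj v₀ y → ¬ G.Adj v₀ z → y = z)
    (hcov : ∀ y ∉ A, y ≠ d → G.Adj v₀ y ∨ G.Adj x y ∨ G.Adj z y) : False := by
  have e1 := hA.le_adjCount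
  have e2 := hB.le_adjCount
  have e3 := card_sub_one_le_sum_adjInd hc
  have e4 := adjCount_split (G := G) (S := A) (W := Finset.univ) (Finset.subset_univ _)
  have e5 := adjCount_split (G := G) (S := {v₀}) (W := A) (by simpa using h0)
  rw [adjCount_singleton_self, Finset.sdiff_singleton_eq_erase,
    adjCount_comm (A.erase v₀) {v₀}] at e5
  have e6 : adjCount G {v₀} (A.erase v₀) = ∑ y ∈ A.erase v₀, adjInd G v₀ y := by simp [adjCount]
  rw [← Finset.compl_eq_univ_sdiff, adjCount_comm Aᶜ A] at e4
  have hsub : ({v₀, x, z} : Finset V) ⊆ A := by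
    intro v hv; simp at hv; rcases hv with rfl | rfl | rfl <;> assumption
  -- By `hcov`, each vertex outside `A` other than `d` receives an edge from one of `v₀`, `x`, `z`.
  have e7 : (Aᶜ.card : ℤ) - 1 ≤ adjCount G A Aᶜ := by
    have f1 : adjCount G {v₀, x, z} Aᶜ ≤ adjCount G A Aᶜ :=
      Finset.sum_le_sum_of_subset_of_nonneg hsub fun i _ _ =>
        Finset.sum_nonneg fun _ _ => adjInd_nonneg _ _
    have f2 : ∑ y ∈ Aᶜ.erase d, (1 : ℤ) ≤ ∑ y ∈ Aᶜ.erase d, ∑ v ∈ {v₀, x, z}, adjInd G y v := by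
      refine Finset.sum_le_sum fun y hy => ?_
      rw [Finset.sum_insert (by simp [hx0.symm, hz0.symm]), Finset.sum_pair hxz]
      have g1 := adjInd_nonneg (G := G) y v₀
      have g2 := adjInd_nonneg (G := G) y x
      have g3 := adjInd_nonneg (G := G) y z
      rcases hcov y (Finset.mem_compl.1 (Finset.mem_of_mem_erase hy)) (Finset.ne_of_mem_erase hy)
        with h | h | h
      · rw [adjInd_of_adj h.symm]; linarith
      · rw [adjInd_of_adj h.symm]; linarith
      · rw [adjInd_of_adj h.symm]; linarith
    have f3 : adjCount G (Aᶜ.erase d) {v₀, x, z} ≤ adjCount G Aᶜ {v₀, x, z} :=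
      Finset.sum_le_sum_of_subset_of_nonneg (Finset.erase_subset _ _) fun i _ _ =>
        Finset.sum_nonneg fun _ _ => adjInd_nonneg _ _
    change _ ≤ adjCount G (Aᶜ.erase d) {v₀, x, z} at f2
    have hd' : d ∈ Aᶜ := Finset.mem_compl.2 hd
    rw [Finset.sum_const, Finset.card_erase_of_mem hd', nsmul_eq_mul,
      Nat.cast_sub (Finset.card_pos.2 ⟨d, hd'⟩)] at f2
    rw [adjCount_comm Aᶜ] at f3
    push_cast at f2
    linarith
  have hcard : (A.card : ℤ) + Aᶜ.card = Fintype.card V := by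
    exact_mod_cast Finset.card_add_card_compl A
  have hn' : (8 : ℤ) ≤ Fintype.card V := by exact_mod_cast hn
  rw [Finset.card_erase_of_mem h0, Nat.cast_sub (Finset.card_pos.2 ⟨v₀, h0⟩)] at e1 e3
  push_cast at e1 e3
  rw [← hcard] at hE hn'
  generalize (A.card : ℤ) = p at *
  generalize (Aᶜ.card : ℤ) = q at *
  -- The counts give twice the adjacency total at least `2 * (p - 1) ^ 2 + 2 * q ^ 2 - 8`, hence at
  -- least `(n - 1) ^ 2 - 8` with `n = p + q`; for `n ≥ 8` this exceeds `n ^ 2 - 4 * n + 4`.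
  nlinarith [sq_nonneg (p - 1 - q)]

/-- Only an exceptional `v₀ ∈ A` adjacent to one of `c`, `d` obstructs `nearComplete_of_not_adj`.
Two missing neighbours of `v₀` give five dissociated vertices, and a vertex missing both `v₀` and
another vertex forces too many crossing edges. -/
lemma IndepFour.nearComplete [Fintype V] [DecidableEq V] {a b c d : V} (h : IndepFour G a b c d)
    (hG : NoFiveDissociated G) (hn : 8 ≤ Fintype.card V)
    (hE : 2 * adjCount G Finset.univ Finset.univ ≤
      (Fintype.card V : ℤ) ^ 2 - 4 * Fintype.card V + 4)
    {A : Finset V} (ha : a ∈ A) (hb : b ∈ A) (hc : c ∉ A) (hd : d ∉ A) (v₀ : V)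
    (hNA : ∀ x ∈ A, x ≠ v₀ → ¬ G.Adj x c ∧ ¬ G.Adj x d)
    (hNB : ∀ x ∉ A, x ≠ v₀ → ¬ G.Adj x a ∧ ¬ G.Adj x b)
    (h0 : v₀ ∈ A → ¬ (G.Adj v₀ c ∧ G.Adj v₀ d)) : NearComplete G A := by
  by_cases hv : v₀ ∈ A ∧ (G.Adj v₀ c ∨ G.Adj v₀ d)
  swap
  · refine h.nearComplete_of_not_adj hG hc hd fun x hx => ?_
    by_cases hx0 : x = v₀
    · subst hx0; tauto
    · exact hNA x hx hx0
  obtain ⟨hvA, hv⟩ := hv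
  wlog hvc : G.Adj v₀ c generalizing c d
  · exact this h.swap_cd hd hc (fun x hx hx0 => (hNA x hx hx0).symm) (fun hv h' => h0 hv h'.symm)
      hv.symm (hv.resolve_left hvc)
  have hvd : ¬ G.Adj v₀ d := fun e => h0 hvA ⟨hvc, e⟩
  have ne : ∀ {u v : V}, u ∈ A → v ∉ A → u ≠ v := fun hu hv e => hv (e ▸ hu)
  have hA' : NearComplete G (A.erase v₀) :=
    h.nearComplete_of_not_adj hG (fun e => hc (Finset.mem_of_mem_erase e))
      (fun e => hd (Finset.mem_of_mem_erase e))
      fun x hx => hNA x (Finset.mem_of_mem_erase hx) (Finset.ne_of_mem_erase hx)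
  have hB : NearComplete G Aᶜ :=
    h.swap_pairs.nearComplete_of_not_adj hG (by simpa using ha) (by simpa using hb)
      fun x hx => hNB x (Finset.mem_compl.1 hx) fun e => Finset.mem_compl.1 hx (e ▸ hvA)
  -- Otherwise the edge `v₀ c`, the pair `y z` and the isolated vertex `d` are dissociated.
  have hcen : ∀ y ∈ A.erase v₀, ∀ z ∈ A.erase v₀, ¬ G.Adj v₀ y → ¬ G.Adj v₀ z → y = z := by
    intro y hy z hz ny nz
    by_contra hyz
    rw [Finset.mem_erase] at hy hz
    obtain ⟨yc, yd⟩ := hNA y hy.2 hy.1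
    obtain ⟨zc, zd⟩ := hNA z hz.2 hz.1
    exact hG.false_of_two_pairs (p := v₀) (q := c) (r := y) (s := z) (t := d) (ne hvA hc)
      hy.1.symm hz.1.symm (ne hvA hd) (ne hy.2 hc).symm (ne hz.2 hc).symm h.cd hyz (ne hy.2 hd)
      (ne hz.2 hd) ny nz hvd (fun e => yc e.symm) (fun e => zc e.symm) h.ncd yd zd
  -- A vertex `y ≠ d` outside `A` that sees none of `v₀`, `x`, `z` would make the pairs `v₀ z`, `d
  -- y` and the isolated vertex `x` dissociated; so the covering hypothesis of
  -- `false_of_exceptional` holds.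
  have hend : ∀ x ∈ A.erase v₀, ∀ z ∈ A.erase v₀, x ≠ z → ¬ G.Adj x v₀ → ¬ G.Adj x z → False := by
    intro x hx z hz hxz nx nxz
    have hx' := Finset.mem_erase.1 hx
    have hz' := Finset.mem_erase.1 hz
    obtain ⟨xc, xd⟩ := hNA x hx'.2 hx'.1
    obtain ⟨zc, zd⟩ := hNA z hz'.2 hz'.1
    refine false_of_exceptional hn hE hvA hx'.2 hz'.2 hx'.1 hz'.1 hxz hd hA' hB hcen ?_
    intro y hy hyd
    by_contra hno
    push Not at hno
    obtain ⟨n1, n2, n3⟩ := hno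
    exact hG.false_of_two_pairs (p := v₀) (q := z) (r := d) (s := y) (t := x) hz'.1.symm
      (ne hvA hd) (ne hvA hy) hx'.1.symm (ne hz'.2 hd) (ne hz'.2 hy) hxz.symm hyd.symm
      (ne hx'.2 hd).symm (ne hx'.2 hy).symm hvd n1 (fun e => nx e.symm) zd n3
      (fun e => nxz e.symm) (fun e => xd e.symm) (fun e => n2 e.symm)
  intro x hx y hy z hz hxy hxz nxy nxz
  by_contra hyz
  by_cases x0 : x = v₀
  · subst x0
    exact hyz (hcen y (by simp [hy, hxy.symm]) z (by simp [hz, hxz.symm]) nxy nxz)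
  by_cases y0 : y = v₀
  · subst y0
    exact hend x (by simp [hx, x0]) z (by simp [hz, Ne.symm hyz]) hxz nxy nxz
  by_cases z0 : z = v₀
  · subst z0
    exact hend x (by simp [hx, x0]) y (by simp [hy, hyz]) hxy nxz nxy
  exact hyz (hA' x (by simp [hx, x0]) y (by simp [hy, y0]) z (by simp [hz, z0]) hxy hxz nxy nxz)

theorem exists_nearComplete_partition [Fintype V] [DecidableEq V] (hG : NoFiveDissociated G)
    (hn : 8 ≤ Fintype.card V)
    (hE : 2 * adjCount G Finset.univ Finset.univ ≤
      (Fintype.card V : ℤ) ^ 2 - 4 * Fintype.card V + 4) :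
    ∃ A : Finset V, A.Nonempty ∧ Aᶜ.Nonempty ∧ NearComplete G A ∧ NearComplete G Aᶜ := by
  classical
  obtain ⟨a, b, c, d, h, v₀, hN, h0⟩ := exists_pairing hG hn hE
  -- The description is symmetric enough that `swap_pairs` handles `Aᶜ`: away from `v₀`, vertices of
  -- `A` miss `c` and `d`, the others miss `a` and `b`.
  set A : Finset V := Finset.univ.filter fun x =>
    x = a ∨ x = b ∨ (x ≠ c ∧ x ≠ d ∧ G.Adj x a ∧ G.Adj x b) with hA
  have ha : a ∈ A := by simp [hA]
  have hb : b ∈ A := by simp [hA]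
  have hc : c ∉ A := by simp [hA, h.ac.symm, h.bc.symm]
  have hd : d ∉ A := by simp [hA, h.ad.symm, h.bd.symm]
  have mem : ∀ x ∈ A, x ≠ a → x ≠ b → x ≠ c ∧ x ≠ d ∧ G.Adj x a ∧ G.Adj x b := fun x hx xa xb =>
    ((Finset.mem_filter.1 hx).2.resolve_left xa).resolve_left xb
  have nmem : ∀ x ∉ A, x ≠ c → x ≠ d → x ≠ a ∧ x ≠ b ∧ ¬ (G.Adj x a ∧ G.Adj x b) := by
    refine fun x hx xc xd => ⟨fun e => hx (e ▸ ha), fun e => hx (e ▸ hb), fun e => hx ?_⟩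
    exact Finset.mem_filter.2 ⟨Finset.mem_univ x, Or.inr (Or.inr ⟨xc, xd, e⟩)⟩
  have hNA : ∀ x ∈ A, x ≠ v₀ → ¬ G.Adj x c ∧ ¬ G.Adj x d := by
    intro x hx hx0
    by_cases xa : x = a
    · rw [xa]; exact ⟨h.nac, h.nad⟩
    by_cases xb : x = b
    · rw [xb]; exact ⟨h.nbc, h.nbd⟩
    obtain ⟨xc, xd, h1, -⟩ := mem x hx xa xb
    rcases hN x ⟨xa, xb, xc, xd⟩ hx0 with h' | h'
    · exact h'.2.2
    · exact absurd h1 h'.1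
  have hNB : ∀ x ∉ A, x ≠ v₀ → ¬ G.Adj x a ∧ ¬ G.Adj x b := by
    intro x hx hx0
    by_cases xc : x = c
    · rw [xc]; exact ⟨fun e => h.nac e.symm, fun e => h.nbc e.symm⟩
    by_cases xd : x = d
    · rw [xd]; exact ⟨fun e => h.nad e.symm, fun e => h.nbd e.symm⟩
    obtain ⟨xa, xb, h1⟩ := nmem x hx xc xd
    rcases hN x ⟨xa, xb, xc, xd⟩ hx0 with h' | h'
    · exact absurd ⟨h'.1, h'.2.1⟩ h1
    · exact ⟨h'.1, h'.2.1⟩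
  refine ⟨A, ⟨a, ha⟩, ⟨c, by simpa using hc⟩, h.nearComplete hG hn hE ha hb hc hd v₀ hNA hNB ?_,
    h.swap_pairs.nearComplete hG hn hE (by simpa using hc) (by simpa using hd) (by simpa using ha)
      (by simpa using hb) v₀ (fun x hx => hNB x (by simpa using hx))
      (fun x hx => hNA x (by simpa using hx)) ?_⟩
  · intro hv h'
    by_cases va : v₀ = a
    · rw [va] at h'; exact h.nac h'.1
    by_cases vb : v₀ = b
    · rw [vb] at h'; exact h.nbc h'.1
    obtain ⟨vc, vd, h1⟩ := mem v₀ hv va vb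
    rcases h0 ⟨va, vb, vc, vd⟩ with h2 | h2
    · exact h2.2.2 h'
    · exact h2.1 h1
  · intro hv h'
    rw [Finset.mem_compl] at hv
    by_cases vc : v₀ = c
    · rw [vc] at h'; exact h.nac h'.1.symm
    by_cases vd : v₀ = d
    · rw [vd] at h'; exact h.nad h'.1.symm
    exact (nmem v₀ hv vc vd).2.2 h'

/-- A connected graph with few edges and no five dissociated vertices is a pair of cocktail party
graphs joined by an edge. -/
theorem exists_tight_partition [Fintype V] [DecidableEq V] (hG : NoFiveDissociated G)
    (hconn : G.Connected) (hn : 8 ≤ Fintype.card V) (h4 : 4 ∣ Fintype.card V)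
    (hE : 2 * adjCount G Finset.univ Finset.univ ≤
      (Fintype.card V : ℤ) ^ 2 - 4 * Fintype.card V + 4) :
    ∃ A : Finset V, 2 * A.card = Fintype.card V ∧
      (∀ x ∈ A, ∃ y ∈ A, y ≠ x ∧ ∀ z ∈ A, z ≠ x → (G.Adj x z ↔ z ≠ y)) ∧
      (∀ x ∉ A, ∃ y ∉ A, y ≠ x ∧ ∀ z ∉ A, z ≠ x → (G.Adj x z ↔ z ≠ y)) ∧
      ∃ u ∈ A, ∃ v ∉ A, ∀ x ∈ A, ∀ y ∉ A, G.Adj x y ↔ x = u ∧ y = v := by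
  obtain ⟨A, hA0, hB0, hA, hB⟩ := exists_nearComplete_partition hG hn hE
  have e1 := hA.le_adjCount
  have e2 := hB.le_adjCount
  have e4 := adjCount_split (G := G) (S := A) (W := Finset.univ) (Finset.subset_univ _)
  rw [← Finset.compl_eq_univ_sdiff, adjCount_comm Aᶜ A] at e4
  have hcard : (A.card : ℤ) + Aᶜ.card = Fintype.card V := by
    exact_mod_cast Finset.card_add_card_compl A
  obtain ⟨u, hu, v, hv, huv⟩ : ∃ u ∈ A, ∃ v ∉ A, G.Adj u v := by
    obtain ⟨a, ha⟩ := hA0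
    obtain ⟨b, hb⟩ := hB0
    obtain ⟨p⟩ := hconn.preconnected a b
    obtain ⟨e, -, h1, h2⟩ := p.exists_boundary_dart (A : Set V) (by simpa using ha)
      (by simpa using hb)
    exact ⟨e.fst, by simpa using h1, e.snd, by simpa using h2, e.adj⟩
  have hv' : v ∈ Aᶜ := Finset.mem_compl.2 hv
  have hcross : adjCount G A Aᶜ = ∑ p ∈ A ×ˢ Aᶜ, adjInd G p.1 p.2 := by
    rw [Finset.sum_product]; rfl
  have huvP : (u, v) ∈ A ×ˢ Aᶜ := Finset.mem_product.2 ⟨hu, hv'⟩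
  have hc1 : 1 ≤ adjCount G A Aᶜ := by
    rw [hcross, ← adjInd_of_adj huv]
    exact Finset.single_le_sum (f := fun p : V × V => adjInd G p.1 p.2)
      (fun p _ => adjInd_nonneg _ _) huvP
  have hsq := sq_nonneg ((A.card : ℤ) - Aᶜ.card)
  -- Four nonnegative terms with nonpositive sum: all vanish, so the parts are balanced, each is
  -- extremal, and one edge crosses.
  have tot : ((A.card : ℤ) - Aᶜ.card) ^ 2 +
      2 * (adjCount G A A - ((A.card : ℤ) ^ 2 - 2 * A.card)) +
      2 * (adjCount G Aᶜ Aᶜ - ((Aᶜ.card : ℤ) ^ 2 - 2 * Aᶜ.card)) +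
      4 * (adjCount G A Aᶜ - 1) ≤ 0 := by
    rw [← hcard] at hE
    nlinarith
  have hpq : (A.card : ℤ) = Aᶜ.card := by
    have : ((A.card : ℤ) - Aᶜ.card) ^ 2 = 0 := by linarith
    have := pow_eq_zero_iff (two_ne_zero) |>.1 this
    linarith
  have tight : ∀ B : Finset V, NearComplete G B →
      adjCount G B B = (B.card : ℤ) ^ 2 - 2 * B.card →
      ∀ x ∈ B, ∃ y ∈ B, y ≠ x ∧ ∀ z ∈ B, z ≠ x → (G.Adj x z ↔ z ≠ y) := by
    intro B hB hBE x hx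
    have hs : ∑ y ∈ B, adjInd G x y = B.card - 2 := by
      refine le_antisymm ?_ (hB.le_sum hx)
      by_contra hlt
      have := Finset.sum_lt_sum (f := fun _ => (B.card : ℤ) - 2)
        (g := fun x => ∑ y ∈ B, adjInd G x y) (fun x hx => hB.le_sum hx)
        ⟨x, hx, by push Not at hlt; exact hlt⟩
      change _ < adjCount G B B at this
      rw [hBE, Finset.sum_const, nsmul_eq_mul] at this
      linarith
    have : ∃ y ∈ B, y ≠ x ∧ ¬ G.Adj x y := by
      by_contra hno
      push Not at hno
      rw [← Finset.add_sum_erase B _ hx, adjInd_of_not_adj G.irrefl, Finset.sum_congr rfl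
        (g := fun _ => (1 : ℤ)) fun y hy => adjInd_of_adj (hno y (Finset.mem_of_mem_erase hy)
          (Finset.ne_of_mem_erase hy)), Finset.sum_const, Finset.card_erase_of_mem hx, nsmul_eq_mul,
        Nat.cast_sub (Finset.card_pos.2 ⟨x, hx⟩)] at hs
      push_cast at hs
      linarith
    obtain ⟨y, hy, hyx, nxy⟩ := this
    refine ⟨y, hy, hyx, fun z hz hzx => ⟨fun h e => nxy (e ▸ h), fun h => ?_⟩⟩
    by_contra n
    exact h (hB x hx z hz y hy hzx.symm hyx.symm n nxy)
  have tA := tight A hA (by linarith)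
  have tB := tight Aᶜ hB (by linarith)
  refine ⟨A, by omega, tA, ?_, u, hu, v, hv, ?_⟩
  · simpa only [Finset.mem_compl] using tB
  · intro x hx y hy
    refine ⟨fun h => ?_, fun ⟨h1, h2⟩ => by rw [h1, h2]; exact huv⟩
    by_contra hne
    have hne' : (x, y) ≠ (u, v) := fun e => hne (by simpa using e)
    have := Finset.sum_le_sum_of_subset_of_nonneg (f := fun p : V × V => adjInd G p.1 p.2)
        (s := {(x, y), (u, v)}) (t := A ×ˢ Aᶜ) (by
          intro p hp
          simp only [Finset.mem_insert, Finset.mem_singleton] at hp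
          rcases hp with rfl | rfl
          · exact Finset.mem_product.2 ⟨hx, Finset.mem_compl.2 hy⟩
          · exact huvP) fun i _ _ => adjInd_nonneg _ _
    rw [Finset.sum_pair hne', ← hcross] at this
    simp only [adjInd_of_adj h, adjInd_of_adj huv] at this
    linarith

end Partition

/-! ### Recognising cocktail party graphs and their joins -/

section CocktailParty

/-- Two fixed-point-free involutions on types of the same size are conjugate. -/
lemma exists_equiv_conj_involution {α β : Type*} [Fintype α] [Fintype β]
    (σ : Equiv.Perm α) (τ : Equiv.Perm β) (hσ : ∀ x, σ (σ x) = x) (hσ' : ∀ x, σ x ≠ x)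
    (hτ : ∀ x, τ (τ x) = x) (hτ' : ∀ x, τ x ≠ x) (hc : Fintype.card α = Fintype.card β) :
    ∃ e : α ≃ β, ∀ x, e (σ x) = τ (e x) := by
  classical
  obtain ⟨f⟩ : Nonempty (α ≃ β) := Fintype.card_eq.1 hc
  -- All cycles of such an involution have length two, so its cycle type, hence its conjugacy class,
  -- depends only on the size of the set.
  have hrep : ∀ ρ : Equiv.Perm α, (∀ x, ρ (ρ x) = x) → (∀ x, ρ x ≠ x) →
      ∃ k, ρ.cycleType = Multiset.replicate k 2 ∧ 2 * k = Fintype.card α := by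
    intro ρ h1 h2
    have hp : ρ ^ 2 = 1 := by ext x; simp [pow_two, h1]
    have := Equiv.Perm.pow_prime_eq_one_iff.1 hp
    refine ⟨ρ.cycleType.card, Multiset.eq_replicate_card.2 this, ?_⟩
    have hs : ρ.support = Finset.univ := by ext x; simp [h2]
    have h3 := ρ.sum_cycleType
    rw [hs, Finset.card_univ, Multiset.eq_replicate_card.2 this] at h3
    simp at h3
    omega
  obtain ⟨k, hk, hk2⟩ := hrep σ hσ hσ'
  obtain ⟨l, hl, hl2⟩ := hrep (f.symm.permCongr τ) (by simp [Equiv.permCongr_apply, hτ]) (by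
    intro x; simp [Equiv.permCongr_apply, Equiv.symm_apply_eq, hτ'])
  obtain rfl : k = l := by omega
  obtain ⟨g, hg⟩ := isConj_iff.1 (Equiv.Perm.isConj_iff_cycleType_eq.2 (hk.trans hl.symm))
  refine ⟨g.trans f, fun x => ?_⟩
  have := congrArg f (Equiv.congr_fun hg (g x))
  simpa [Equiv.permCongr_apply] using this

lemma cocktailParty_adj {d : ℕ} {x y : Fin (d / 2) × Fin 2} :
    (cocktailParty d).Adj x y ↔ x ≠ y ∧ y ≠ (x.1, x.2 + 1) := by
  obtain ⟨i, a⟩ := x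
  obtain ⟨j, b⟩ := y
  simp only [cocktailParty, SimpleGraph.compl_adj, pairMatching, ne_eq, Prod.mk.injEq, not_and]
  have : ∀ a b : Fin 2, b = a + 1 ↔ a ≠ b := by decide
  rw [this]
  grind

/-- Sending a vertex to its unique non-neighbour is a fixed-point-free involution, and conjugating
it to the standard one gives the isomorphism. Vertex-transitivity then allows `u₀` to be sent to any
prescribed `u`. -/
lemma exists_iso_cocktailParty {α : Type*} [Fintype α] (K : SimpleGraph α) {d : ℕ} (hd : 2 ∣ d)
    (hc : Fintype.card α = d) (hK : ∀ x, ∃ y, y ≠ x ∧ ∀ z, z ≠ x → (K.Adj x z ↔ z ≠ y)) (u₀ : α)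
    (u : Fin (d / 2) × Fin 2) : ∃ e : K ≃g cocktailParty d, e u₀ = u := by
  choose s hs1 hs2 using hK
  have hss : ∀ x, s (s x) = x := by
    intro x
    by_contra hne
    have h1 := (hs2 (s x) x (hs1 x).symm).2 (Ne.symm hne)
    exact (hs2 x (s x) (hs1 x)).1 h1.symm rfl
  have h2 : ∀ a : Fin 2, a + 1 + 1 = a ∧ a + 1 ≠ a := by decide
  let τ : Equiv.Perm (Fin (d / 2) × Fin 2) :=
    Function.Involutive.toPerm (fun x => (x.1, x.2 + 1)) fun x => Prod.ext rfl (h2 x.2).1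
  obtain ⟨e, he⟩ := exists_equiv_conj_involution (Function.Involutive.toPerm s hss) τ hss hs1
    (fun x => Prod.ext rfl (h2 x.2).1) (fun x h => (h2 x.2).2 (congrArg Prod.snd h)) (by
      rw [hc]; simp; omega)
  have he' : ∀ x, e (s x) = ((e x).1, (e x).2 + 1) := he
  -- An automorphism carrying `e u₀` to `u`: permuting the pairs, or the two places in every pair,
  -- preserves the matching.
  let g : (Fin (d / 2) × Fin 2) ≃ (Fin (d / 2) × Fin 2) :=
    (Equiv.swap (e u₀).1 u.1).prodCongr (Equiv.swap (e u₀).2 u.2)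
  have hg : ∀ x y, (cocktailParty d).Adj (g x) (g y) ↔ (cocktailParty d).Adj x y := by
    intro x y
    simp only [cocktailParty, SimpleGraph.compl_adj, pairMatching, g.injective.ne_iff]
    simp [g]
  refine ⟨⟨e.trans g, ?_⟩, ?_⟩
  · intro x y
    change (cocktailParty d).Adj (g (e x)) (g (e y)) ↔ _
    rw [hg, cocktailParty_adj, e.injective.ne_iff, ← he', e.injective.ne_iff]
    by_cases hxy : x = y
    · subst hxy; simp
    · simp [hs2 x y (Ne.symm hxy), hxy]
  · exact Prod.ext (Equiv.swap_apply_left _ _) (Equiv.swap_apply_left _ _)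

lemma connectByEdge_inl_inl {V₁ V₂ : Type*} {C₁ : SimpleGraph V₁} {C₂ : SimpleGraph V₂} {u : V₁}
    {v : V₂} {x y : V₁} : (connectByEdge C₁ C₂ u v).Adj (Sum.inl x) (Sum.inl y) ↔ C₁.Adj x y := by
  simp [connectByEdge, SimpleGraph.edge_adj]

lemma connectByEdge_inr_inr {V₁ V₂ : Type*} {C₁ : SimpleGraph V₁} {C₂ : SimpleGraph V₂} {u : V₁}
    {v : V₂} {x y : V₂} : (connectByEdge C₁ C₂ u v).Adj (Sum.inr x) (Sum.inr y) ↔ C₂.Adj x y := by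
  simp [connectByEdge, SimpleGraph.edge_adj]

lemma connectByEdge_inl_inr {V₁ V₂ : Type*} {C₁ : SimpleGraph V₁} {C₂ : SimpleGraph V₂} {u : V₁}
    {v : V₂} {x : V₁} {y : V₂} :
    (connectByEdge C₁ C₂ u v).Adj (Sum.inl x) (Sum.inr y) ↔ x = u ∧ y = v := by
  simp [connectByEdge, SimpleGraph.edge_adj]

lemma connectByEdge_inr_inl {V₁ V₂ : Type*} {C₁ : SimpleGraph V₁} {C₂ : SimpleGraph V₂} {u : V₁}
    {v : V₂} {x : V₁} {y : V₂} :
    (connectByEdge C₁ C₂ u v).Adj (Sum.inr y) (Sum.inl x) ↔ x = u ∧ y = v := by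
  rw [SimpleGraph.adj_comm, connectByEdge_inl_inr]

/-- A graph made of two parts which are cocktail party graphs, with one edge between them. -/
theorem nonempty_iso_connectByEdge {V : Type*} [Fintype V] [DecidableEq V] {G : SimpleGraph V}
    {d : ℕ} (hd : 2 ∣ d) (hV : Fintype.card V = 2 * d) {A : Finset V}
    (hA : 2 * A.card = Fintype.card V)
    (h1 : ∀ x ∈ A, ∃ y ∈ A, y ≠ x ∧ ∀ z ∈ A, z ≠ x → (G.Adj x z ↔ z ≠ y))
    (h2 : ∀ x ∉ A, ∃ y ∉ A, y ≠ x ∧ ∀ z ∉ A, z ≠ x → (G.Adj x z ↔ z ≠ y))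
    {u₀ v₀ : V} (hu : u₀ ∈ A) (hv : v₀ ∉ A)
    (h3 : ∀ x ∈ A, ∀ y ∉ A, G.Adj x y ↔ x = u₀ ∧ y = v₀) (u v : Fin (d / 2) × Fin 2) :
    Nonempty (G ≃g connectByEdge (cocktailParty d) (cocktailParty d) u v) := by
  obtain ⟨e₁, he₁⟩ := exists_iso_cocktailParty (G.induce {x | x ∈ A}) hd
    (by simp; omega) (by
      rintro ⟨x, hx⟩
      obtain ⟨y, hy, hyx, h⟩ := h1 x hx
      exact ⟨⟨y, hy⟩, by simpa using hyx, fun ⟨z, hz⟩ hzx => by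
        simpa using h z hz (by simpa using hzx)⟩) ⟨u₀, hu⟩ u
  obtain ⟨e₂, he₂⟩ := exists_iso_cocktailParty (G.induce {x | ¬ x ∈ A}) hd
    (by
      have := Fintype.card_subtype_compl fun x => x ∈ A
      simp only [Fintype.card_coe] at this
      change Fintype.card {x // ¬ x ∈ A} = d
      rw [this]; omega) (by
      rintro ⟨x, hx⟩
      obtain ⟨y, hy, hyx, h⟩ := h2 x hx
      exact ⟨⟨y, hy⟩, by simpa using hyx, fun ⟨z, hz⟩ hzx => by
        simpa using h z hz (by simpa using hzx)⟩) ⟨v₀, hv⟩ v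
  let f : {x // x ∈ A} ⊕ {x // ¬ x ∈ A} ≃ V := Equiv.sumCompl (fun x => x ∈ A)
  refine ⟨(⟨(Equiv.sumCongr e₁.toEquiv e₂.toEquiv).symm.trans f, ?_⟩ :
    connectByEdge (cocktailParty d) (cocktailParty d) u v ≃g G).symm⟩
  intro p q
  obtain ⟨p, rfl⟩ := (Equiv.sumCongr e₁.toEquiv e₂.toEquiv).surjective p
  obtain ⟨q, rfl⟩ := (Equiv.sumCongr e₁.toEquiv e₂.toEquiv).surjective q
  simp only [Equiv.trans_apply, Equiv.symm_apply_apply]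
  have m1 : ∀ x y, (cocktailParty d).Adj (e₁ x) (e₁ y) ↔ G.Adj x.1 y.1 := fun x y => e₁.map_adj_iff
  have m2 : ∀ x y, (cocktailParty d).Adj (e₂ x) (e₂ y) ↔ G.Adj x.1 y.1 := fun x y => e₂.map_adj_iff
  have m3 : ∀ x, e₁ x = u ↔ x.1 = u₀ := fun x => by
    rw [← he₁, e₁.injective.eq_iff, Subtype.ext_iff]
  have m4 : ∀ x, e₂ x = v ↔ x.1 = v₀ := fun x => by
    rw [← he₂, e₂.injective.eq_iff, Subtype.ext_iff]
  rcases p with x | x <;> rcases q with y | y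
  · change G.Adj x.1 y.1 ↔ (connectByEdge _ _ u v).Adj (Sum.inl (e₁ x)) (Sum.inl (e₁ y))
    rw [connectByEdge_inl_inl, m1]
  · change G.Adj x.1 y.1 ↔ (connectByEdge _ _ u v).Adj (Sum.inl (e₁ x)) (Sum.inr (e₂ y))
    rw [connectByEdge_inl_inr, h3 x.1 x.2 y.1 y.2, m3, m4]
  · change G.Adj x.1 y.1 ↔ (connectByEdge _ _ u v).Adj (Sum.inr (e₂ x)) (Sum.inl (e₁ y))
    rw [connectByEdge_inr_inl, G.adj_comm, h3 y.1 y.2 x.1 x.2, m3, m4]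
  · change G.Adj x.1 y.1 ↔ (connectByEdge _ _ u v).Adj (Sum.inr (e₂ x)) (Sum.inr (e₂ y))
    rw [connectByEdge_inr_inr, m2]

end CocktailParty

/-! ### Lower and upper bounds for the spectral radius -/

section Spectral

variable {V : Type*} [Fintype V]

open Classical in
lemma spectrum_adjMatrix_finite (G : SimpleGraph V) : (spectrum ℝ (G.adjMatrix ℝ)).Finite := by
  rw [(Matrix.isHermitian_iff_isSelfAdjoint.2 (show IsSelfAdjoint (G.adjMatrix ℝ) by
    exact G.isSymm_adjMatrix)).spectrum_real_eq_range_eigenvalues]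
  exact Set.finite_range _

open Classical in
lemma graphSpectralRadius_mem [Nonempty V] (G : SimpleGraph V) :
    graphSpectralRadius G ∈ spectrum ℝ (G.adjMatrix ℝ) := by
  have h : (G.adjMatrix ℝ).IsHermitian := by
    simp [Matrix.IsHermitian]
  refine (spectrum_adjMatrix_finite G).isCompact.sSup_mem ?_
  rw [h.spectrum_real_eq_range_eigenvalues]
  exact Set.range_nonempty _

-- The Rayleigh quotient of the all-ones vector: the spectral radius times the identity minus the
-- adjacency matrix is positive semidefinite.
open Classical in
lemma sum_degree_le_card_mul_graphSpectralRadius (G : SimpleGraph V) :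
    ∑ v, (G.degree v : ℝ) ≤ Fintype.card V * graphSpectralRadius G := by
  set A := G.adjMatrix ℝ with hA
  have h : A.IsHermitian := by simp [Matrix.IsHermitian, hA]
  have hps : (algebraMap ℝ (Matrix V V ℝ) (graphSpectralRadius G) - A).PosSemidef := by
    rw [Matrix.posSemidef_iff_isHermitian_and_spectrum_nonneg]
    refine ⟨?_, ?_⟩
    · refine Matrix.IsHermitian.sub ?_ h
      simp [Matrix.IsHermitian, Matrix.algebraMap_eq_diagonal]
    · intro x hx
      rw [← spectrum.singleton_sub_eq] at hx
      obtain ⟨a, ha, b, hb, rfl⟩ := hx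
      rw [Set.mem_singleton_iff] at ha
      subst ha
      have := le_csSup (spectrum_adjMatrix_finite G).bddAbove hb
      simpa [graphSpectralRadius] using this
  have := hps.dotProduct_mulVec_nonneg (fun _ => (1 : ℝ))
  simp only [Matrix.sub_mulVec, dotProduct_sub, Matrix.algebraMap_eq_diagonal] at this
  simp [dotProduct, Matrix.mulVec_diagonal, hA, SimpleGraph.adjMatrix_mulVec_apply] at this
  linarith

-- A Collatz–Wielandt bound. Comparing an eigenvector `y` with `x` at a vertex maximising `|y v| / x
-- v` avoids any need for a positive eigenvector.
open Classical in
lemma graphSpectralRadius_lt_of_test [Nonempty V] (G : SimpleGraph V) (x : V → ℝ) (c : ℝ)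
    (hx : ∀ v, 0 < x v) (h : ∀ v, ∑ w, (if G.Adj v w then x w else 0) < c * x v) :
    graphSpectralRadius G < c := by
  have hm := graphSpectralRadius_mem G
  rw [← Matrix.spectrum_toLin', ← Module.End.hasEigenvalue_iff_mem_spectrum] at hm
  obtain ⟨y, hy⟩ := hm.exists_hasEigenvector
  have hy0 := hy.2
  have hyA := hy.apply_eq_smul
  set r := graphSpectralRadius G
  obtain ⟨i, -, hi⟩ := Finset.exists_max_image Finset.univ (fun v => |y v| / x v)
    Finset.univ_nonempty
  set t := |y i| / x i with ht
  have hyt : ∀ v, |y v| ≤ t * x v := fun v => by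
    have := hi v (Finset.mem_univ v)
    rwa [div_le_iff₀ (hx v)] at this
  have hyi : |y i| = t * x i := by rw [ht, div_mul_cancel₀ _ (hx i).ne']
  have htpos : 0 < t := by
    rcases (div_nonneg (abs_nonneg (y i)) (hx i).le).lt_or_eq with h0 | h0
    · exact h0
    · exfalso
      apply hy0
      funext v
      have := hyt v
      rw [ht, ← h0, zero_mul] at this
      exact abs_nonpos_iff.1 this
  have key : r * y i = ∑ w, (if G.Adj i w then y w else 0) := by
    have := congrFun hyA i
    rw [Matrix.toLin'_apply, SimpleGraph.adjMatrix_mulVec_apply] at this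
    rw [← Finset.sum_filter, ← SimpleGraph.neighborFinset_eq_filter]
    simpa using this.symm
  have h1 : r * |y i| ≤ t * ∑ w, (if G.Adj i w then x w else 0) := by
    calc r * |y i| ≤ |r * y i| := by
          rw [abs_mul]; exact mul_le_mul_of_nonneg_right (le_abs_self r) (abs_nonneg _)
      _ ≤ ∑ w, |if G.Adj i w then y w else 0| := by rw [key]; exact Finset.abs_sum_le_sum_abs _ _
      _ ≤ ∑ w, t * (if G.Adj i w then x w else 0) := by
          refine Finset.sum_le_sum fun w _ => ?_
          split_ifs
          · exact hyt w
          · simp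
      _ = _ := by rw [Finset.mul_sum]
  have h2 := h i
  have hxi := hx i
  rw [hyi] at h1
  have h3 : r * x i < c * x i := by
    have : r * x i ≤ ∑ w, (if G.Adj i w then x w else 0) := by
      refine le_of_mul_le_mul_left ?_ htpos
      linarith
    linarith
  exact lt_of_mul_lt_mul_right h3 hxi.le

lemma graphSpectralRadius_congr {W : Type*} [Fintype W] {G : SimpleGraph V} {H : SimpleGraph W}
    (e : G ≃g H) : graphSpectralRadius G = graphSpectralRadius H := by
  classical
  unfold graphSpectralRadius
  have : H.adjMatrix ℝ = Matrix.reindexAlgEquiv ℝ ℝ e.toEquiv (G.adjMatrix ℝ) := by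
    ext i j
    have := e.symm.map_adj_iff (v := i) (w := j)
    simp only [SimpleGraph.adjMatrix_apply, Matrix.coe_reindexAlgEquiv, Matrix.reindex_apply,
      Matrix.submatrix_apply]
    exact if_congr this.symm rfl rfl
  rw [← AlgEquiv.spectrum_eq (Matrix.reindexAlgEquiv ℝ ℝ e.toEquiv) (G.adjMatrix ℝ)]
  congr! 2
  convert this.symm

end Spectral

/-! ### Dissociation sets in elementary terms, and isomorphism invariance -/

section Dissociation

variable {V : Type*} [Fintype V]

lemma isDissociationSet_iff {G : SimpleGraph V} {S : Finset V} :
    IsDissociationSet G S ↔ ∀ x ∈ S, ∀ y ∈ S, ∀ z ∈ S, G.Adj x y → G.Adj x z → y = z := by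
  classical
  have : IsDissociationSet G S ↔ ∀ v : (S : Set V), (G.induce (S : Set V)).degree v ≤ 1 := by
    unfold IsDissociationSet
    constructor
    · intro h v
      refine le_trans ?_ h
      convert SimpleGraph.degree_le_maxDegree _ v
    · intro h
      refine SimpleGraph.maxDegree_le_of_forall_degree_le _ _ fun v => ?_
      convert h v
  rw [this]
  constructor
  · intro h x hx y hy z hz hxy hxz
    have h1 := h ⟨x, hx⟩
    rw [← SimpleGraph.card_neighborFinset_eq_degree, Finset.card_le_one] at h1
    simpa using h1 ⟨y, hy⟩ (by simpa using hxy) ⟨z, hz⟩ (by simpa using hxz)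
  · rintro h ⟨x, hx⟩
    rw [← SimpleGraph.card_neighborFinset_eq_degree, Finset.card_le_one]
    rintro ⟨y, hy⟩ hxy ⟨z, hz⟩ hxz
    simp only [SimpleGraph.mem_neighborFinset, SimpleGraph.comap_adj] at hxy hxz
    exact Subtype.ext (h x hx y hy z hz hxy hxz)

lemma card_le_dissociationNumber {G : SimpleGraph V} {S : Finset V} (h : IsDissociationSet G S) :
    S.card ≤ dissociationNumber G := by
  classical
  unfold dissociationNumber
  exact Finset.le_sup (f := Finset.card) (by simpa using h)

lemma dissociationNumber_le {G : SimpleGraph V} {k : ℕ}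
    (h : ∀ S, IsDissociationSet G S → S.card ≤ k) : dissociationNumber G ≤ k := by
  classical
  unfold dissociationNumber
  exact Finset.sup_le fun S hS => h S (by simpa using hS)

lemma noFiveDissociated_of_dissociationNumber {G : SimpleGraph V} (h : dissociationNumber G = 4) :
    NoFiveDissociated G := fun _ hS =>
  h ▸ card_le_dissociationNumber (isDissociationSet_iff.2 hS)

lemma dissociationNumber_le_of_iso {W : Type*} [Fintype W] {G : SimpleGraph V}
    {H : SimpleGraph W} (e : G ≃g H) : dissociationNumber G ≤ dissociationNumber H := by
  refine dissociationNumber_le fun S hS => ?_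
  rw [isDissociationSet_iff] at hS
  rw [← Finset.card_map e.toEquiv.toEmbedding]
  refine card_le_dissociationNumber (isDissociationSet_iff.2 ?_)
  simp only [Finset.mem_map_equiv]
  intro x hx y hy z hz hxy hxz
  exact e.symm.injective (hS _ hx _ hy _ hz (e.symm.map_adj_iff.2 hxy) (e.symm.map_adj_iff.2 hxz))

lemma IsConnectedWithDissociation.congr {W : Type*} [Fintype W] {G : SimpleGraph V}
    {H : SimpleGraph W} {n k : ℕ} (e : G ≃g H) (h : IsConnectedWithDissociation n k G) :
    IsConnectedWithDissociation n k H :=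
  ⟨(Fintype.card_congr e.toEquiv).symm.trans h.1, e.connected_iff.1 h.2.1,
    (le_antisymm (dissociationNumber_le_of_iso e.symm) (dissociationNumber_le_of_iso e)).trans
      h.2.2⟩

end Dissociation

/-! ### The extremal graph: membership and spectral estimate -/

section Extremal

variable {d : ℕ}

/-- Among three vertices some two are adjacent; the third would then be a common non-neighbour of
both, yet it has only one non-neighbour. -/
lemma card_le_two_of_cocktailParty {S : Finset (Fin (d / 2) × Fin 2)}
    (h : ∀ x ∈ S, ∀ y ∈ S, ∀ z ∈ S, (cocktailParty d).Adj x y → (cocktailParty d).Adj x z → y = z) :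
    S.card ≤ 2 := by
  by_contra hlt
  obtain ⟨x, hx, y, hy, z, hz, hxy, hxz, hyz⟩ := Finset.two_lt_card.1 (not_le.1 hlt)
  have h2 : ∀ a : Fin 2, a + 1 + 1 = a := by decide
  have key : ∀ x ∈ S, ∀ y ∈ S, ∀ z ∈ S, x ≠ y → x ≠ z → y ≠ z → (cocktailParty d).Adj x y →
      False := by
    intro x hx y hy z hz hxy hxz hyz hadj
    have n1 : ¬ (cocktailParty d).Adj x z := fun e => hyz (h x hx y hy z hz hadj e)
    have n2 : ¬ (cocktailParty d).Adj y z := fun e => hxz (h y hy x hx z hz hadj.symm e)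
    simp only [cocktailParty_adj, hxz, hyz, ne_eq, not_false_eq_true, true_and, not_not] at n1 n2
    rw [n1] at n2
    simp only [Prod.mk.injEq, add_left_inj] at n2
    exact hxy (Prod.ext n2.1 n2.2)
  by_cases e : (cocktailParty d).Adj x y
  · exact key x hx y hy z hz hxy hxz hyz e
  · refine key x hx z hz y hy hxz hxy hyz.symm (cocktailParty_adj.2 ⟨hxz, fun e' => hyz ?_⟩)
    rw [cocktailParty_adj] at e
    simp only [hxy, ne_eq, not_false_eq_true, true_and, not_not] at e
    rw [e, e']

lemma sum_cocktailParty (hd : 2 ∣ d) (x : Fin (d / 2) × Fin 2) [DecidableRel (cocktailParty d).Adj] :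
    ∑ y, (if (cocktailParty d).Adj x y then (1 : ℝ) else 0) = d - 2 := by
  have h2 : ∀ a : Fin 2, a + 1 ≠ a := by decide
  have hne : x ≠ (x.1, x.2 + 1) := fun e => h2 x.2 (congrArg Prod.snd e).symm
  have h : ∀ y, (if (cocktailParty d).Adj x y then (1 : ℝ) else 0) =
      1 - (if y = x then 1 else 0) - (if y = (x.1, x.2 + 1) then 1 else 0) := by
    intro y
    simp only [cocktailParty_adj]
    by_cases h1 : y = x
    · subst h1; simp [hne]
    · by_cases h3 : y = (x.1, x.2 + 1) <;> simp [h1, h3, Ne.symm h1]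
      exact fun e => h1 (h3.trans e)
  rw [Finset.sum_congr rfl fun y _ => h y, Finset.sum_sub_distrib, Finset.sum_sub_distrib,
    Finset.sum_ite_eq' Finset.univ x, Finset.sum_ite_eq' Finset.univ (x.1, x.2 + 1)]
  obtain ⟨m, rfl⟩ := hd
  simp
  ring

lemma degree_cocktailParty (hd : 2 ∣ d) (x : Fin (d / 2) × Fin 2)
    [Fintype ((cocktailParty d).neighborSet x)] : (cocktailParty d).degree x + 2 = d := by
  classical
  have := sum_cocktailParty hd x
  rw [Finset.sum_boole] at this
  have h3 : (cocktailParty d).degree x =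
      (Finset.univ.filter fun y => (cocktailParty d).Adj x y).card := by
    rw [← SimpleGraph.card_neighborFinset_eq_degree]
    congr 1
    ext; simp
  rw [← h3] at this
  have h4 : ((cocktailParty d).degree x : ℝ) + 2 = d := by linarith
  exact_mod_cast h4

lemma cocktailParty_reachable (h4 : 4 ≤ d) (x y : Fin (d / 2) × Fin 2) :
    (cocktailParty d).Reachable x y := by
  by_cases hxy : x = y
  · rw [hxy]
  by_cases h : (cocktailParty d).Adj x y
  · exact h.reachable
  obtain ⟨j, hj⟩ : ∃ j : Fin (d / 2), j ≠ x.1 := by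
    have : Nontrivial (Fin (d / 2)) := Fin.nontrivial_iff_two_le.2 (by omega)
    exact exists_ne _
  have hy : y = (x.1, x.2 + 1) := by
    rw [cocktailParty_adj] at h
    simpa [hxy] using h
  have h1 : (cocktailParty d).Adj x (j, 0) :=
    cocktailParty_adj.2 ⟨fun e => hj (congrArg Prod.fst e).symm, fun e => hj (congrArg Prod.fst e)⟩
  have h2 : (cocktailParty d).Adj y (j, 0) := by
    rw [hy]
    exact cocktailParty_adj.2
      ⟨fun e => hj (congrArg Prod.fst e).symm, fun e => hj (congrArg Prod.fst e)⟩
  exact h1.reachable.trans h2.reachable.symm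

variable (u v : Fin (d / 2) × Fin 2)

lemma connected_connectByEdge (h4 : 4 ≤ d) :
    (connectByEdge (cocktailParty d) (cocktailParty d) u v).Connected := by
  set G := connectByEdge (cocktailParty d) (cocktailParty d) u v
  let f₁ : cocktailParty d →g G := ⟨Sum.inl, fun h => connectByEdge_inl_inl.2 h⟩
  let f₂ : cocktailParty d →g G := ⟨Sum.inr, fun h => connectByEdge_inr_inr.2 h⟩
  have huv : G.Reachable (Sum.inl u) (Sum.inr v) :=
    (connectByEdge_inl_inr.2 ⟨rfl, rfl⟩ : G.Adj (Sum.inl u) (Sum.inr v)).reachable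
  refine SimpleGraph.connected_iff_exists_forall_reachable _ |>.2 ⟨Sum.inl u, ?_⟩
  rintro (x | x)
  · exact (cocktailParty_reachable h4 u x).map f₁
  · exact huv.trans ((cocktailParty_reachable h4 v x).map f₂)

lemma dissociationNumber_connectByEdge (h4 : 4 ≤ d) :
    dissociationNumber (connectByEdge (cocktailParty d) (cocktailParty d) u v) = 4 := by
  classical
  refine le_antisymm (dissociationNumber_le fun S hS => ?_) ?_
  · rw [isDissociationSet_iff] at hS
    rw [← Finset.card_toLeft_add_card_toRight]
    have h1 : S.toLeft.card ≤ 2 := card_le_two_of_cocktailParty fun x hx y hy z hz hxy hxz =>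
      Sum.inl_injective (hS _ (Finset.mem_toLeft.1 hx) _ (Finset.mem_toLeft.1 hy) _
        (Finset.mem_toLeft.1 hz) (connectByEdge_inl_inl.2 hxy) (connectByEdge_inl_inl.2 hxz))
    have h2 : S.toRight.card ≤ 2 := card_le_two_of_cocktailParty fun x hx y hy z hz hxy hxz =>
      Sum.inr_injective (hS _ (Finset.mem_toRight.1 hx) _ (Finset.mem_toRight.1 hy) _
        (Finset.mem_toRight.1 hz) (connectByEdge_inr_inr.2 hxy) (connectByEdge_inr_inr.2 hxz))
    omega
  · let i : Fin (d / 2) := ⟨0, by omega⟩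
    -- Two copies of a non-adjacent pair: at most the connecting edge runs between them.
    let T : Finset (Fin (d / 2) × Fin 2) := {i} ×ˢ Finset.univ
    have hT : ∀ x ∈ T, ∀ y ∈ T, ¬ (cocktailParty d).Adj x y := by
      intro x hx y hy hxy
      simp only [T, Finset.mem_product, Finset.mem_singleton, Finset.mem_univ, and_true] at hx hy
      simp [cocktailParty, pairMatching, hx, hy, Prod.ext_iff] at hxy
    have hc : (T.disjSum T).card = 4 := by simp [T]
    rw [← hc]
    refine card_le_dissociationNumber (isDissociationSet_iff.2 ?_)
    rintro (x | x) hx (y | y) hy (z | z) hz hxy hxz <;>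
      simp only [Finset.inl_mem_disjSum, Finset.inr_mem_disjSum] at hx hy hz <;>
      simp only [connectByEdge_inl_inl, connectByEdge_inr_inr, connectByEdge_inl_inr,
        connectByEdge_inr_inl] at hxy hxz <;> first
        | exact absurd hxy (hT _ hx _ hy)
        | exact absurd hxz (hT _ hx _ hz)
        | rw [hxy.2, hxz.2]
        | rw [hxy.1, hxz.1]

lemma isConnectedWithDissociation_connectByEdge (hd : 2 ∣ d) (h4 : 4 ≤ d) :
    IsConnectedWithDissociation (2 * d) 4
      (connectByEdge (cocktailParty d) (cocktailParty d) u v) := by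
  refine ⟨?_, connected_connectByEdge u v h4, dissociationNumber_connectByEdge u v h4⟩
  simp
  omega

lemma graphSpectralRadius_connectByEdge_lt (hd : 2 ∣ d) (h4 : 4 ≤ d) :
    graphSpectralRadius (connectByEdge (cocktailParty d) (cocktailParty d) u v) <
      d - 2 + 2 / d := by
  classical
  have hd4 : (4 : ℝ) ≤ d := by exact_mod_cast h4
  -- The test vector is `1`, raised to `1 + δ` at `u` and `v`. Neighbours of these within their own
  -- copies require `δ < 2 / d`, and `u`, `v` themselves require `δ > 1 / (d - 1)`; the chosen `δ`
  -- is the mediant of the two bounds.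
  set δ : ℝ := 3 / (2 * d - 1) with hδ
  have hδ0 : 0 < δ := by apply div_pos <;> linarith
  have hδ1 : δ < 2 / d := by
    rw [hδ, div_lt_div_iff₀ (by linarith) (by linarith)]; linarith
  have hδ2 : (d : ℝ) - 2 + (1 + δ) < (d - 2 + 2 / d) * (1 + δ) := by
    have h5 : 1 < (d - 1) * δ := by
      rw [hδ, mul_div_assoc', lt_div_iff₀ (by linarith)]; linarith
    have h6 : (d : ℝ) - 2 < (d - 2) / d * ((d - 1) * (1 + δ)) := by
      rw [div_mul_eq_mul_div, lt_div_iff₀ (by linarith)]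
      exact mul_lt_mul_of_pos_left (by linarith) (by linarith)
    have h7 : (d - 2 : ℝ) / d * ((d - 1) * (1 + δ)) = (d - 2 + 2 / d) * (1 + δ) - (1 + δ) := by
      field_simp; ring
    linarith
  have hrow : ∀ w x : Fin (d / 2) × Fin 2, ∑ y, (if (cocktailParty d).Adj x y then
      1 + (if y = w then δ else 0) else 0) = d - 2 + if (cocktailParty d).Adj x w then δ else 0 := by
    intro w x
    have : ∀ y, (if (cocktailParty d).Adj x y then 1 + (if y = w then δ else 0) else 0) =
        (if (cocktailParty d).Adj x y then 1 else 0) +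
          if y = w then (if (cocktailParty d).Adj x w then δ else 0) else 0 := by
      intro y
      by_cases h : y = w
      · subst h; split_ifs <;> simp
      · simp [h]
    rw [Finset.sum_congr rfl fun y _ => this y, Finset.sum_add_distrib, sum_cocktailParty hd,
      Finset.sum_ite_eq' Finset.univ w]
    simp
  have hfin : ∀ w x : Fin (d / 2) × Fin 2,
      ((d : ℝ) - 2 + if (cocktailParty d).Adj x w then δ else 0) + (if x = w then 1 + δ else 0) <
        (d - 2 + 2 / d) * (1 + if x = w then δ else 0) := by
    intro w x
    by_cases h : x = w
    · subst h; simpa using hδ2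
    · simp only [h, if_false, add_zero, mul_one]
      split_ifs <;> linarith
  have : Nonempty (Fin (d / 2)) := ⟨⟨0, by omega⟩⟩
  refine graphSpectralRadius_lt_of_test _
    (Sum.elim (fun x => 1 + if x = u then δ else 0) (fun y => 1 + if y = v then δ else 0)) _ ?_ ?_
  · rintro (x | x) <;> simp only [Sum.elim_inl, Sum.elim_inr] <;> split_ifs <;> linarith
  · rintro (x | x)
    · rw [Fintype.sum_sum_type]
      simp only [connectByEdge_inl_inl, connectByEdge_inl_inr, Sum.elim_inl, Sum.elim_inr]
      convert hfin u x using 2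
      · rw [← hrow]
      · by_cases h : x = u <;> simp [h]
    · rw [Fintype.sum_sum_type]
      simp only [connectByEdge_inr_inl, connectByEdge_inr_inr, Sum.elim_inl, Sum.elim_inr]
      rw [add_comm]
      convert hfin v x using 2
      · rw [← hrow]
      · by_cases h : x = v <;> simp [h]

end Extremal

/-! ### From the spectral radius to the structure, and the theorem -/

lemma adjCount_univ {V : Type*} [Fintype V] (G : SimpleGraph V) [DecidableRel G.Adj] :
    adjCount G Finset.univ Finset.univ = ∑ v, (G.degree v : ℤ) := by
  refine Finset.sum_congr rfl fun v _ => ?_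
  rw [← SimpleGraph.card_neighborFinset_eq_degree, SimpleGraph.neighborFinset_eq_filter,
    Finset.card_filter]
  push_cast
  refine Finset.sum_congr rfl fun y _ => ?_
  by_cases h : G.Adj v y <;> simp [adjInd, h]

/-- A graph whose spectral radius is small is the graph formed by two joined cocktail party
graphs. -/
theorem nonempty_iso_of_graphSpectralRadius_lt {V : Type*} [Fintype V] {d : ℕ} (hd : 2 ∣ d)
    (h4 : 4 ≤ d) {G : SimpleGraph V} (hG : IsConnectedWithDissociation (2 * d) 4 G)
    (hr : graphSpectralRadius G < d - 2 + 2 / d) (u v : Fin (d / 2) × Fin 2) :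
    Nonempty (G ≃g connectByEdge (cocktailParty d) (cocktailParty d) u v) := by
  classical
  obtain ⟨hV, hconn, hτ⟩ := hG
  have hdeg := sum_degree_le_card_mul_graphSpectralRadius G
  have hd4 : (4 : ℝ) ≤ d := by exact_mod_cast h4
  have hsum : ∑ v, (G.degree v : ℝ) < 2 * d * (d - 2) + 4 := by
    rw [hV] at hdeg
    have : (2 * d : ℝ) * graphSpectralRadius G < 2 * d * (d - 2 + 2 / d) :=
      mul_lt_mul_of_pos_left hr (by linarith)
    have h' : (2 * d : ℝ) * (d - 2 + 2 / d) = 2 * d * (d - 2) + 4 := by field_simp; ring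
    push_cast at hdeg
    linarith
  have hE : 2 * adjCount G Finset.univ Finset.univ ≤
      (Fintype.card V : ℤ) ^ 2 - 4 * Fintype.card V + 4 := by
    have h1 : adjCount G Finset.univ Finset.univ < 2 * d * (d - 2) + 4 := by
      rw [adjCount_univ]; exact_mod_cast hsum
    -- Parity matters: the degree sum is even and below `2 * d * (d - 2) + 4`, so only one edge
    -- beyond the minimum remains possible.
    have h2 : adjCount G Finset.univ Finset.univ = 2 * (G.edgeFinset.card : ℤ) := by
      rw [adjCount_univ]; exact_mod_cast G.sum_degrees_eq_twice_card_edges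
    have h3 : (G.edgeFinset.card : ℤ) ≤ d * (d - 2) + 1 := by
      by_contra hlt
      have : (d : ℤ) * (d - 2) + 2 ≤ G.edgeFinset.card := by omega
      linarith
    rw [hV]
    push_cast
    linarith
  obtain ⟨A, hA, h1, h2, u₀, hu, v₀, hv, h3⟩ := exists_tight_partition
    (noFiveDissociated_of_dissociationNumber hτ) hconn (by omega) (by omega) hE
  exact nonempty_iso_connectByEdge hd hV hA h1 h2 hu hv h3 u v

theorem mainTheorem4 (n : ℕ) (hn : 8 ≤ n) (h4 : n ≡ 0 [MOD 4]) :
    (∃ u v, IsGoodConnectingEdge (cocktailParty (n / 2)) (cocktailParty (n / 2)) u v) ∧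
    ∀ u v, IsGoodConnectingEdge (cocktailParty (n / 2)) (cocktailParty (n / 2)) u v →
      IsSpectralMinimizer n 4
          (connectByEdge (cocktailParty (n / 2)) (cocktailParty (n / 2)) u v) ∧
      ∀ {V : Type*} [Fintype V] (G : SimpleGraph V), IsSpectralMinimizer n 4 G →
        Nonempty (G ≃g connectByEdge (cocktailParty (n / 2)) (cocktailParty (n / 2)) u v) := by
  classical
  obtain ⟨d, rfl, hd, hd4⟩ : ∃ d, n = 2 * d ∧ 2 ∣ d ∧ 4 ≤ d := by
    have := (Nat.modEq_zero_iff_dvd).1 h4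
    exact ⟨n / 2, by omega, by omega, by omega⟩
  rw [Nat.mul_div_cancel_left d (by norm_num)]
  have hgood : ∀ u v, IsGoodConnectingEdge (cocktailParty d) (cocktailParty d) u v := by
    intro u v
    have hc : Fintype.card (Fin (d / 2) × Fin 2) = d := by simp; omega
    exact ⟨by rw [hc]; exact degree_cocktailParty hd u,
      by rw [hc]; exact degree_cocktailParty hd v⟩
  let w : Fin (d / 2) × Fin 2 := (⟨0, by omega⟩, 0)
  refine ⟨⟨w, w, hgood w w⟩, fun u v _ => ?_⟩
  have hG₀ := isConnectedWithDissociation_connectByEdge u v hd hd4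
  have hlt := graphSpectralRadius_connectByEdge_lt u v hd hd4
  refine ⟨⟨hG₀, fun H hH => ?_⟩, fun {V} _ G hG => ?_⟩
  · by_contra hno
    obtain ⟨e⟩ := nonempty_iso_of_graphSpectralRadius_lt hd hd4 hH ((not_le.1 hno).trans hlt) u v
    exact hno (graphSpectralRadius_congr e).ge
  -- Minimality is tested against graphs on `Fin n`, so the extremal graph is first moved there.
  · let e := SimpleGraph.Iso.comap (Fintype.equivFinOfCardEq hG₀.1).symm
      (connectByEdge (cocktailParty d) (cocktailParty d) u v)
    have h := hG.2 _ (hG₀.congr e.symm)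
    rw [graphSpectralRadius_congr e] at h
    exact nonempty_iso_of_graphSpectralRadius_lt hd hd4 hG.1 (h.trans_lt hlt) u v
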